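/- Conventions. A spin factor is a complex Hilbert space $X$, of dimension at least $3$, with inner product $\langle\cdot|\cdot\rangle$ (linear in the first variable) and a conjugation $x\mapsto\overline{x}$ (a conjugate-linear isometry of period $2$), with the triple product $\{x,y,z\}=\langle x|y\rangle z+\langle z|y\rangle x-\langle x|\overline{z}\rangle\overline{y}$ and the norm $\|x\|^2=\langle x|x\rangle+\sqrt{\langle x|x\rangle^2-|\langle x|\overline{x}\rangle|^2}$. Put $X^-=\{x\in X:\overline{x}=x\}$, $Q(b)(c)=\{b,c,b\}$, and for $S\subseteq X$ let $S^{\perp_2}_X$ be its orthogonal complement in the Hilbert space $X$. An element $a$ is a truncation of $b$ if $\{a,a,a\}=\{a,b,a\}$. A tripotent is an $e$ with $\{e,e,e\}=e$; its Peirce subspaces are $X_j(e)=\{x:\{e,e,x\}=\frac{j}{2}x\}$, $j=0,1,2$, and it is minimal if $X_2(e)=\mathbb{C}e\neq\{0\}$. A JB$^*$-subtriple is a closed linear subspace that is closed under the triple product. $M_2$ and $S_2$ are the spaces of all, respectively of all symmetric, complex $2\times2$ matrices with $\{A,B,C\}=\frac12(AB^*C+CB^*A)$ and the operator norm; $\cong$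 means isometrically triple isomorphic, that is, isomorphic by a linear bijection preserving triple products and norms. Proposition. Let $X,Y$ be spin factors and let $\Delta:X\to Y$ be a (not necessarily linear or continuous) bijection preserving the truncation of triple products in both directions: for all $a,b,c\in X$, $a$ is a truncation of $Q(b)(c)$ if and only if $\Delta(a)$ is a truncation of $Q(\Delta(b))(\Delta(c))$. Then: (a) For each $\gamma\in\mathbb{C}$ with $|\gamma|=1$ and each norm-one $x\in X^-$ there exist $\gamma'\in\mathbb{C}$ with $|\gamma'|=1$ and a norm-one $y\in Y^-$ such that $\Delta(\gamma x)=\gamma' y$. (b) For each orthonormal system $(a,b)$ in $X^-$ there is a unique orthonormal system $(a',b')$ in $Y^-$ with $\Delta\left(\frac{a+ib}{2}\right)=\frac{a'+ib'}{2}$. Moreover, for $e_1=\frac{a+ib}{2}$ we have $X_1(e_1)\oplus X_0(e_1)=\{a,b\}^{\perp_2}_X\oplus\mathbb{C}\frac{a-ib}{2}$, and $$\Delta\left(\{a,b\}^{\perp_2}_X\oplus\mathbb{C}\tfrac{a-ib}{2}\right)=\{a',b'\}^{\perp_2}_Y\oplus\mathbb{C}\tfrac{a'-ib'}{2}.$$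 (c) For $a,b,e_1,a',b'$ as in (b), $$\Delta(X_1(e_1))=\Delta(\{a,b\}^{\perp_2}_X)=\{a',b'\}^{\perp_2}_Y=Y_1(\Delta(e_1))=\left\{\Delta\left(\tfrac{a+ib}{2}\right),\Delta\left(\tfrac{a-ib}{2}\right)\right\}^{\perp_2}_Y$$ (with $X_1(e_1)=\{a,b\}^{\perp_2}_X$) and $\Delta(X_0(e_1))=Y_0(\Delta(e_1))$. (d) For each orthonormal system $(a,b,c)$ in $X^-$ at least one of the following holds: (d.1) the JB$^*$-subtriple $S$ of $X$ generated by $\{a,b,c\}$ satisfies $S\cong S_2$, and $\Delta(S)$ is a JB$^*$-subtriple of $Y$ with $\Delta(S)\cong S_2$; (d.2) there is $d$ such that $(a,b,c,d)$ is an orthonormal system in $X^-$, the JB$^*$-subtriple $M$ of $X$ generated by $\{a,b,c,d\}$ satisfies $M\cong M_2$, and $\Delta(M)$ is a JB$^*$-subtriple of $Y$ with $\Delta(M)\cong M_2$. Consequently, given any two minimal tripotents $e,v$ in $X$, there exist JB$^*$-subtriples $M\subseteq X$ and $N\subseteq Y$ with $e,v\in M$, $\Delta(M)=N$, and either $M,N\cong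 M_2$ or $M,N\cong S_2$. -/

import Mathlib

/-- A (complex) spin factor: a complex Hilbert space `X` of dimension at least three together with
a conjugation, that is, a conjugate-linear isometry of period two. -/
structure SpinFactor (X : Type*) [NormedAddCommGroup X] [InnerProductSpace ℂ X]
    [CompleteSpace X] where
  /-- the conjugation `x ↦ x̄` -/
  conj : X →ₗᵢ⋆[ℂ] X
  conj_conj : ∀ x, conj (conj x) = x
  three_le_rank : 3 ≤ Module.rank ℂ X

namespace SpinFactor

variable {X : Type*} [NormedAddCommGroup X] [InnerProductSpace ℂ X] [CompleteSpace X]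

/-- The triple product `{x, y, z} = ⟨x|y⟩ z + ⟨z|y⟩ x - ⟨x|z̄⟩ ȳ`, where `⟨x|y⟩` is linear in `x`;
Mathlib's inner product is linear in the second variable, so `⟨x|y⟩` is `inner ℂ y x`. -/
noncomputable def tp (S : SpinFactor X) (x y z : X) : X :=
  inner ℂ y x • z + inner ℂ y z • x - inner ℂ (S.conj z) x • S.conj y

/-- The norm of the spin factor as a JB*-triple:
`‖x‖² = ⟨x|x⟩ + √(⟨x|x⟩² - |⟨x|x̄⟩|²)`. (The norm `‖x‖` of Lean is the Hilbert norm.) -/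
noncomputable def spinNorm (S : SpinFactor X) (x : X) : ℝ :=
  Real.sqrt (‖x‖ ^ 2 + Real.sqrt ((‖x‖ ^ 2) ^ 2 - ‖inner ℂ (S.conj x) x‖ ^ 2))

/-- The triple norm and the Hilbert norm are equivalent, so that they have the same closed sets. -/
theorem norm_le_spinNorm (S : SpinFactor X) (x : X) : ‖x‖ ≤ S.spinNorm x :=
  Real.le_sqrt_of_sq_le (le_add_of_nonneg_right (Real.sqrt_nonneg _))

theorem spinNorm_le (S : SpinFactor X) (x : X) : S.spinNorm x ≤ Real.sqrt 2 * ‖x‖ := by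
  have h : Real.sqrt ((‖x‖ ^ 2) ^ 2 - ‖inner ℂ (S.conj x) x‖ ^ 2) ≤ ‖x‖ ^ 2 :=
    Real.sqrt_le_iff.2 ⟨by positivity, sub_le_self _ (by positivity)⟩
  unfold spinNorm
  refine Real.sqrt_le_iff.2 ⟨by positivity, ?_⟩
  rw [mul_pow, Real.sq_sqrt (by norm_num)]
  linarith

/-- The operator `L(a, b) : z ↦ {a, b, z}`. -/
noncomputable def L (S : SpinFactor X) (a b : X) : Module.End ℂ X where
  toFun z := S.tp a b z
  map_add' z w := by
    simp only [tp, map_add, inner_add_left, inner_add_right, add_smul, smul_add]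
    abel
  map_smul' r z := by
    simp only [tp, inner_smul_right, LinearIsometry.map_smulₛₗ, inner_smul_left,
      RingHom.id_apply, RingHomCompTriple.comp_apply, smul_sub, smul_add, mul_smul,
      smul_comm r]

/-- The conjugate-linear operator `Q(b) : c ↦ {b, c, b}`. -/
noncomputable def Q (S : SpinFactor X) (b c : X) : X := S.tp b c b

/-- `a` is a truncation of `b` if `{a, a, a} = {a, b, a}`. -/
def IsTruncation (S : SpinFactor X) (a b : X) : Prop := S.tp a a a = S.tp a b a

/-- A tripotent is an element `e` with `{e, e, e} = e`. -/
def IsTripotent (S : SpinFactor X) (e : X) : Prop := S.tp e e e = e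

/-- The Peirce-`j` subspace `X_j(e) = {a | L(e, e) a = (j / 2) a}`, for `j = 0, 1, 2`. -/
noncomputable def peirce (S : SpinFactor X) (j : ℕ) (e : X) : Submodule ℂ X :=
  Module.End.eigenspace (S.L e e) ((j : ℂ) / 2)

/-- A minimal tripotent is a tripotent `e` with `X_2(e) = ℂ e ≠ {0}`. -/
def IsMinimalTripotent (S : SpinFactor X) (e : X) : Prop :=
  S.IsTripotent e ∧ S.peirce 2 e = Submodule.span ℂ {e} ∧ e ≠ 0

/-- The family `v` is an orthonormal system in the real Hilbert space
`X⁻ = {x | x̄ = x}` of fixed points of the conjugation. -/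
def RealOrthonormal (S : SpinFactor X) {n : ℕ} (v : Fin n → X) : Prop :=
  (∀ i, S.conj (v i) = v i) ∧ Orthonormal ℂ v

/-- A JB*-subtriple: a closed linear subspace that is closed under the triple product. -/
def IsSubtriple (S : SpinFactor X) (M : Submodule ℂ X) : Prop :=
  IsClosed (M : Set X) ∧ ∀ x ∈ M, ∀ y ∈ M, ∀ z ∈ M, S.tp x y z ∈ M

/-- The JB*-subtriple generated by a set: the smallest JB*-subtriple that contains it. -/
noncomputable def generated (S : SpinFactor X) (s : Set X) : Submodule ℂ X :=
  sInf {M : Submodule ℂ X | S.IsSubtriple M ∧ s ⊆ M}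

end SpinFactor

/-- The orthogonal complement of a set in a complex Hilbert space. -/
noncomputable def hilbertPerp {X : Type*} [NormedAddCommGroup X] [InnerProductSpace ℂ X]
    (s : Set X) : Submodule ℂ X := (Submodule.span ℂ s)ᗮ

/-- The element `(a + i b) / 2`. -/
noncomputable def halfPlus {X : Type*} [AddCommGroup X] [Module ℂ X] (a b : X) : X :=
  (2⁻¹ : ℂ) • (a + Complex.I • b)

/-- The element `(a - i b) / 2`. -/
noncomputable def halfMinus {X : Type*} [AddCommGroup X] [Module ℂ X] (a b : X) : X :=
  (2⁻¹ : ℂ) • (a - Complex.I • b)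

/-- The triple product `{A, B, C} = (A B* C + C B* A) / 2` of complex 2 by 2 matrices. -/
noncomputable def matrixTp (A B C : Matrix (Fin 2) (Fin 2) ℂ) : Matrix (Fin 2) (Fin 2) ℂ :=
  (2⁻¹ : ℂ) • (A * B.conjTranspose * C + C * B.conjTranspose * A)

/-- The JB*-triple `M_2` of all complex 2 by 2 matrices, as a subspace of itself. -/
def matrixM2 : Submodule ℂ (Matrix (Fin 2) (Fin 2) ℂ) := ⊤

/-- The JB*-triple `S_2` of all symmetric complex 2 by 2 matrices. -/
def matrixS2 : Submodule ℂ (Matrix (Fin 2) (Fin 2) ℂ) where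
  carrier := {A | A.transpose = A}
  add_mem' {A B} hA hB := by
    change (A + B).transpose = A + B
    rw [Matrix.transpose_add, show A.transpose = A from hA, show B.transpose = B from hB]
  zero_mem' := by simp
  smul_mem' r A hA := by
    change (r • A).transpose = r • A
    rw [Matrix.transpose_smul, show A.transpose = A from hA]

/-- `S_2` is closed under the triple product of matrices. -/
theorem matrixTp_mem_matrixS2 {A B C : Matrix (Fin 2) (Fin 2) ℂ} (hA : A ∈ matrixS2)
    (hB : B ∈ matrixS2) (hC : C ∈ matrixS2) : matrixTp A B C ∈ matrixS2 := by
  have hA' : A.transpose = A := hA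
  have hB' : B.transpose = B := hB
  have hC' : C.transpose = C := hC
  have hB'' : B.conjTranspose.transpose = B.conjTranspose := by
    rw [Matrix.conjTranspose, hB', ← Matrix.transpose_map, hB']
  change (matrixTp A B C).transpose = matrixTp A B C
  simp only [matrixTp, Matrix.transpose_smul, Matrix.transpose_add, Matrix.transpose_mul, hA',
    hB'', hC', Matrix.mul_assoc]
  rw [add_comm]

namespace SpinFactor

variable {X : Type*} [NormedAddCommGroup X] [InnerProductSpace ℂ X] [CompleteSpace X]

/-- `M` is a JB*-subtriple of the spin factor, and it is isometrically triple isomorphic to `V`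
(either `M_2` or `S_2`, with the triple product `matrixTp` and the operator norm): there is a linear
bijection from `V` onto `M` that preserves triple products and norms. -/
def IsIsomorphicTo (S : SpinFactor X) (M : Submodule ℂ X)
    (V : Submodule ℂ (Matrix (Fin 2) (Fin 2) ℂ)) : Prop :=
  S.IsSubtriple M ∧ ∃ φ : V ≃ₗ[ℂ] M,
    (∀ A B C D : V, (D : Matrix (Fin 2) (Fin 2) ℂ) = matrixTp A B C →
      (φ D : X) = S.tp (φ A) (φ B) (φ C)) ∧
    ∀ A : V, S.spinNorm (φ A) = ‖Matrix.toEuclideanCLM (n := Fin 2) (𝕜 := ℂ) A‖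

end SpinFactor

/-- The map `Δ` preserves the truncation of triple products in both directions: `a` is a truncation
of `Q(b)(c)` if and only if `Δ(a)` is a truncation of `Q(Δ(b))(Δ(c))`. -/
def PreservesTruncations {X Y : Type*}
    [NormedAddCommGroup X] [InnerProductSpace ℂ X] [CompleteSpace X]
    [NormedAddCommGroup Y] [InnerProductSpace ℂ Y] [CompleteSpace Y]
    (S : SpinFactor X) (T : SpinFactor Y) (Δ : X → Y) : Prop :=
  ∀ a b c : X, S.IsTruncation a (S.Q b c) ↔ T.IsTruncation (Δ a) (T.Q (Δ b) (Δ c))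

/-!
# Bijections between spin factors that preserve truncations of triple products

Everything is read off from the relation "`a` is a truncation of `Q(b)(c)`".

Zero is the only truncation of zero, while every element is a truncation of itself; hence
`Q(b)(c) = 0` is preserved. An element `e` is a tripotent if and only if it is a truncation of
`Q(e)(e)`, and for tripotents truncation is the usual order. A nonzero tripotent of a spin factor
has rank one, `e = (a + ib)/2` with `a`, `b` real and orthonormal, or rank two, `γx` with `x` a real
unit vector and `|γ| = 1`; the former are the minimal ones, so both kinds are preserved. For `e` of
rank one, `Q(e)(x) = 2⟨e|x⟩e`, so the Hilbert orthogonality of `e` to an arbitrary element is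
preserved, and the line `ℂe` is determined by the kernel of `Q(e)`. The line of the conjugate `ē`
contains precisely those rank-one tripotents orthogonal to `e` that have a common upper bound with
`e`. The Peirce spaces `X₀(e) = ℂē` and `X₁(e) = {e, ē}^⊥` are therefore preserved.

The main step is that orthogonality to a rank-two tripotent `g` is preserved as well
(`PreservesTruncations.inner_map_isRankTwo_eq_zero_iff`), if the dimension is at least four. For `e`
of rank one the relation `e ⊥ Q(b)(c)` is preserved for all `b`, `c`, because it fails exactly if a
nonzero multiple of `e` is a truncation of `Q(b)(c)`. Now `Q(g)(x)` is a combination of `g` and `x̄`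
with coefficient `2⟨g|x⟩` at `g`, and rank-one tripotents are numerous enough to separate `x̄` from
the line `ℂg`. So `x` is orthogonal to `g` or a multiple of it exactly if each rank-one tripotent
orthogonal to `x̄` is orthogonal to `Q(g)(x)`.

The span of a real orthonormal system is an intersection of hyperplanes orthogonal to rank-two
tripotents. Its image is then a linear subspace invariant under the conjugation, and its dimension,
three or four, is controlled by the rank-one tripotents it contains. The spans of three and of four
real orthonormal vectors are copies of `S₂` and `M₂`: in suitable coordinates the determinant is a
sum of squares, and the operator norm depends only on the Hilbert-Schmidt norm and the determinant.
Finally, two rank-one tripotents lie in a common span of three or four real orthonormal vectors.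
-/

/-! ### Tripotents of a spin factor and the truncation order -/

namespace SpinFactor

variable {X : Type*} [NormedAddCommGroup X] [InnerProductSpace ℂ X] [CompleteSpace X]

theorem conj_two_inv : starRingEnd ℂ (2⁻¹ : ℂ) = 2⁻¹ := by
  rw [map_inv₀, Complex.conj_ofNat]

theorem inner_conj_conj (S : SpinFactor X) (x y : X) :
    inner ℂ (S.conj x) (S.conj y) = inner ℂ y x := by
  have re_eq : ∀ u w : X, (inner ℂ (S.conj u) (S.conj w)).re = (inner ℂ u w).re := by
    intro u w
    have h1 := norm_add_sq (𝕜 := ℂ) u w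
    have h2 := norm_add_sq (𝕜 := ℂ) (S.conj u) (S.conj w)
    rw [← map_add, S.conj.norm_map, S.conj.norm_map, S.conj.norm_map] at h2
    simp only [RCLike.re_to_complex] at h1 h2
    linarith
  have h1 := re_eq x y
  have h2 := re_eq x (Complex.I • y)
  rw [LinearIsometry.map_smulₛₗ, inner_smul_right, inner_smul_right] at h2
  apply Complex.ext
  · rw [h1, show inner ℂ y x = starRingEnd ℂ (inner ℂ x y) from (inner_conj_symm y x).symm,
      Complex.conj_re]
  · rw [show inner ℂ y x = starRingEnd ℂ (inner ℂ x y) from (inner_conj_symm y x).symm,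
      Complex.conj_im]
    simpa using h2

/-- The bilinear form `(x, y) ↦ ⟨y|x̄⟩` is symmetric. -/
theorem inner_conj_left (S : SpinFactor X) (x y : X) :
    inner ℂ (S.conj x) y = inner ℂ (S.conj y) x := by
  rw [← S.inner_conj_conj y (S.conj x), S.conj_conj]

theorem inner_conj_right (S : SpinFactor X) (x y : X) :
    inner ℂ x (S.conj y) = inner ℂ y (S.conj x) := by
  rw [← S.inner_conj_conj (S.conj y) x, S.conj_conj]

theorem conj_smul (S : SpinFactor X) (r : ℂ) (x : X) :
    S.conj (r • x) = starRingEnd ℂ r • S.conj x := LinearIsometry.map_smulₛₗ _ _ _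

theorem Q_eq (S : SpinFactor X) (b c : X) :
    S.Q b c = (2 * inner ℂ c b) • b - inner ℂ (S.conj b) b • S.conj c := by
  rw [Q, tp, two_mul, add_smul]

theorem Q_zero_right (S : SpinFactor X) (b : X) : S.Q b 0 = 0 := by simp [Q_eq]

theorem Q_zero_left (S : SpinFactor X) (c : X) : S.Q 0 c = 0 := by simp [Q_eq]

theorem Q_smul_left (S : SpinFactor X) (r : ℂ) (b c : X) : S.Q (r • b) c = (r * r) • S.Q b c := by
  simp only [Q_eq, inner_smul_right, conj_smul, inner_smul_left, Complex.conj_conj, smul_sub,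
    smul_smul]
  ring_nf

theorem Q_smul_right (S : SpinFactor X) (r : ℂ) (b c : X) :
    S.Q b (r • c) = starRingEnd ℂ r • S.Q b c := by
  simp only [Q_eq, conj_smul, inner_smul_left, smul_sub, smul_smul]
  ring_nf

/-- A nonzero element is never annihilated by its own quadratic operator. -/
theorem eq_zero_of_Q_self (S : SpinFactor X) {a : X} (h : S.Q a a = 0) : a = 0 := by
  by_contra ha
  have hN : inner ℂ a a ≠ (0 : ℂ) := inner_self_ne_zero.2 ha
  rw [Q_eq, sub_eq_zero] at h
  have h1 := congrArg (fun z => inner ℂ (S.conj a) z) h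
  simp only [inner_smul_right, S.inner_conj_conj] at h1
  have h2 : inner ℂ (S.conj a) a = 0 := by
    have : inner ℂ a a * inner ℂ (S.conj a) a = 0 := by linear_combination h1
    exact (mul_eq_zero.1 this).resolve_left hN
  rw [h2, zero_smul, smul_eq_zero] at h
  rcases h with h | h
  · exact hN (by simpa using h)
  · exact ha h

/-- A tripotent of rank one, described by the Hilbert space structure: an isotropic vector for the
symmetric bilinear form `⟨x|ȳ⟩` with `⟨e|e⟩ = 1/2`. -/
def IsRankOne (S : SpinFactor X) (e : X) : Prop :=
  inner ℂ (S.conj e) e = (0 : ℂ) ∧ inner ℂ e e = (2⁻¹ : ℂ)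

/-- A tripotent of rank two, described by the Hilbert space structure: a unit vector that spans a
complex line invariant under the conjugation. -/
def IsRankTwo (S : SpinFactor X) (u : X) : Prop :=
  inner ℂ u u = (1 : ℂ) ∧ ∃ κ : ℂ, S.conj u = κ • u

theorem IsRankOne.ne_zero {S : SpinFactor X} {e : X} (he : S.IsRankOne e) : e ≠ 0 := by
  rintro rfl
  have := he.2
  norm_num at this

theorem IsRankTwo.ne_zero {S : SpinFactor X} {e : X} (he : S.IsRankTwo e) : e ≠ 0 := by
  rintro rfl
  have := he.1
  norm_num at this

theorem IsRankOne.conj {S : SpinFactor X} {e : X} (he : S.IsRankOne e) : S.IsRankOne (S.conj e) := by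
  refine ⟨?_, by rw [S.inner_conj_conj, he.2]⟩
  rw [S.conj_conj, ← inner_conj_symm, he.1, map_zero]

theorem IsRankOne.inner_conj {S : SpinFactor X} {e : X} (he : S.IsRankOne e) :
    inner ℂ e (S.conj e) = (0 : ℂ) := by
  rw [← inner_conj_symm, he.1, map_zero]

theorem IsRankOne.Q_eq {S : SpinFactor X} {e : X} (he : S.IsRankOne e) (x : X) :
    S.Q e x = (2 * inner ℂ x e) • e := by
  rw [SpinFactor.Q_eq, he.1, zero_smul, sub_zero]

theorem IsRankOne.Q_eq_zero_iff {S : SpinFactor X} {e : X} (he : S.IsRankOne e) (x : X) :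
    S.Q e x = 0 ↔ inner ℂ e x = (0 : ℂ) := by
  rw [he.Q_eq, smul_eq_zero_iff_left he.ne_zero, inner_eq_zero_symm]
  simp

theorem IsRankOne.smul {S : SpinFactor X} {e : X} (he : S.IsRankOne e) {γ : ℂ} (hγ : ‖γ‖ = 1) :
    S.IsRankOne (γ • e) := by
  constructor
  · rw [S.conj_smul, inner_smul_left, inner_smul_right, he.1]; simp
  · rw [inner_smul_left, inner_smul_right, he.2, ← mul_assoc, Complex.conj_mul', hγ]; simp

theorem mul_conj_eq_one {S : SpinFactor X} {u : X} {κ : ℂ} (hu : u ≠ 0)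
    (hκ : S.conj u = κ • u) : κ * starRingEnd ℂ κ = 1 := by
  have h := congrArg S.conj hκ
  rw [S.conj_conj, S.conj_smul, hκ, smul_smul] at h
  have h2 : (starRingEnd ℂ κ * κ - 1) • u = 0 := by rw [sub_smul, ← h, one_smul, sub_self]
  rcases smul_eq_zero.1 h2 with h3 | h3
  · linear_combination h3
  · exact absurd h3 hu

/-- An element of rank two is a unimodular multiple of a unit vector fixed by the conjugation. -/
theorem IsRankTwo.exists_real {S : SpinFactor X} {u : X} (hu : S.IsRankTwo u) :
    ∃ (γ : ℂ) (x : X), ‖γ‖ = 1 ∧ S.conj x = x ∧ ‖x‖ = 1 ∧ u = γ • x := by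
  obtain ⟨h1, κ, hκ⟩ := hu
  have hu : u ≠ 0 := by rintro rfl; norm_num at h1
  have hnu : ‖u‖ = 1 := by
    have h2 := norm_sq_eq_re_inner (𝕜 := ℂ) u
    rw [h1, RCLike.one_re] at h2
    nlinarith [norm_nonneg u]
  have hm := mul_conj_eq_one hu hκ
  obtain ⟨δ, hδ⟩ := IsAlgClosed.exists_pow_nat_eq κ (n := 2) two_pos
  replace hδ : κ = δ * δ := by rw [← hδ, sq]
  have hκn : ‖κ‖ = 1 := by
    rw [Complex.mul_conj'] at hm
    have : ‖κ‖ ^ 2 = 1 := by exact_mod_cast hm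
    nlinarith [norm_nonneg κ]
  have hδn : ‖δ‖ = 1 := by
    have : ‖δ‖ * ‖δ‖ = 1 := by rw [← norm_mul, ← hδ, hκn]
    nlinarith [norm_nonneg δ]
  have hδ1 : starRingEnd ℂ δ * δ = 1 := by rw [Complex.conj_mul', hδn]; simp
  refine ⟨starRingEnd ℂ δ, δ • u, by simpa using hδn, ?_, by rw [norm_smul, hδn, hnu, one_mul], ?_⟩
  · rw [S.conj_smul, hκ, smul_smul, hδ, ← mul_assoc, hδ1, one_mul]
  · rw [smul_smul, hδ1, one_smul]

theorem isRankTwo_smul {S : SpinFactor X} {γ : ℂ} {x : X} (hγ : ‖γ‖ = 1) (hx : S.conj x = x)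
    (hn : ‖x‖ = 1) : S.IsRankTwo (γ • x) := by
  have h1 : starRingEnd ℂ γ * γ = 1 := by rw [Complex.conj_mul', hγ]; simp
  refine ⟨?_, starRingEnd ℂ γ * starRingEnd ℂ γ, ?_⟩
  · rw [inner_self_eq_norm_sq_to_K, norm_smul, hγ, hn]; simp
  · rw [S.conj_smul, hx, smul_smul, mul_assoc, h1, mul_one]

/-- For a nonzero element the fifth power equals the third one only if it has rank one or two. -/
theorem rank_of_Q_Q_self {S : SpinFactor X} {e : X} (he : e ≠ 0)
    (h : S.Q e e = S.Q e (S.Q e e)) : S.IsRankOne e ∨ S.IsRankTwo e := by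
  have hN0 : inner ℂ e e ≠ (0 : ℂ) := inner_self_ne_zero.2 he
  have hNr : starRingEnd ℂ (inner ℂ e e) = inner ℂ e e := inner_conj_symm e e
  have hβ' : inner ℂ e (S.conj e) = starRingEnd ℂ (inner ℂ (S.conj e) e) := (inner_conj_symm _ _).symm
  set N : ℂ := inner ℂ e e with hN
  set β : ℂ := inner ℂ (S.conj e) e with hβ
  have h5 : (4 * N * N - β * starRingEnd ℂ β - 2 * N) • e = ((2 * N - 1) * β) • S.conj e := by
    have e1 : S.Q e e = (2 * N) • e - β • S.conj e := S.Q_eq e e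
    have e2 : S.Q e (S.Q e e) =
        (4 * N * N - β * starRingEnd ℂ β) • e - (2 * N * β) • S.conj e := by
      rw [S.Q_eq e (S.Q e e), e1, inner_sub_left, inner_smul_left, inner_smul_left, map_sub,
        S.conj_smul, S.conj_smul, S.conj_conj, ← hN, ← hβ]
      simp only [map_mul, hNr, map_ofNat]
      module
    rw [e2, e1] at h
    have h' : (4 * N * N - β * starRingEnd ℂ β) • e - (2 * N * β) • S.conj e -
      ((2 * N) • e - β • S.conj e) = 0 := by rw [← h, sub_self]
    rw [← sub_eq_zero, ← h']
    module
  by_cases hb : β = 0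
  · left
    refine ⟨hb, ?_⟩
    rw [hb] at h5
    simp only [zero_mul, sub_zero, mul_zero, zero_smul, smul_eq_zero, he, or_false] at h5
    have : N * (2 * N - 1) = 0 := by linear_combination h5 / 2
    rcases mul_eq_zero.1 this with h6 | h6
    · exact absurd h6 hN0
    · rw [← hN]; linear_combination h6 / 2
  · right
    have h2N : 2 * N - 1 ≠ 0 := by
      intro h6
      rw [h6, zero_mul, zero_smul, smul_eq_zero] at h5
      rcases h5 with h5 | h5
      · have : β * starRingEnd ℂ β = 0 := by linear_combination 2 * N * h6 - h5
        rcases mul_eq_zero.1 this with h7 | h7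
        · exact hb h7
        · exact hb (by simpa using h7)
      · exact he h5
    have hκ : S.conj e =
        (((2 * N - 1) * β)⁻¹ * (4 * N * N - β * starRingEnd ℂ β - 2 * N)) • e := by
      rw [mul_smul, h5, smul_smul, inv_mul_cancel₀ (mul_ne_zero h2N hb), one_smul]
    set κ : ℂ := ((2 * N - 1) * β)⁻¹ * (4 * N * N - β * starRingEnd ℂ β - 2 * N) with hκd
    have hm := mul_conj_eq_one he hκ
    have hβκ : β = starRingEnd ℂ κ * N := by rw [hβ, hκ, inner_smul_left]
    have hββ : β * starRingEnd ℂ β = N * N := by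
      have h8 : starRingEnd ℂ β = κ * N := by rw [hβκ, map_mul, Complex.conj_conj, hNr]
      rw [h8]; linear_combination N * κ * hβκ + N * N * hm
    refine ⟨?_, κ, hκ⟩
    rw [hκ, smul_smul] at h5
    have h6 : (4 * N * N - β * starRingEnd ℂ β - 2 * N) = (2 * N - 1) * β * κ := by
      have : ((4 * N * N - β * starRingEnd ℂ β - 2 * N) - (2 * N - 1) * β * κ) • e = 0 := by
        rw [sub_smul, h5, sub_self]
      exact sub_eq_zero.1 ((smul_eq_zero.1 this).resolve_right he)
    have hβκ2 : β * κ = N := by rw [hβκ]; linear_combination N * hm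
    have : N * (N - 1) = 0 := by linear_combination h6 + hββ + (2 * N - 1) * hβκ2
    rw [← hN]
    exact sub_eq_zero.1 ((mul_eq_zero.1 this).resolve_left hN0)

theorem IsRankOne.Q_self {S : SpinFactor X} {e : X} (he : S.IsRankOne e) : S.Q e e = e := by
  rw [he.Q_eq, he.2]; norm_num

theorem IsRankTwo.Q_eq {S : SpinFactor X} {u : X} {κ : ℂ} (hu : inner ℂ u u = (1 : ℂ))
    (hκ : S.conj u = κ • u) (x : X) :
    S.Q u x = (2 * inner ℂ x u) • u - starRingEnd ℂ κ • S.conj x := by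
  rw [SpinFactor.Q_eq, hκ, inner_smul_left, hu, mul_one]

theorem IsRankTwo.Q_self {S : SpinFactor X} {u : X} (hu : S.IsRankTwo u) : S.Q u u = u := by
  have h0 := hu.ne_zero
  obtain ⟨h1, κ, hκ⟩ := hu
  have hm := mul_conj_eq_one h0 hκ
  rw [IsRankTwo.Q_eq h1 hκ, h1, hκ, smul_smul, mul_comm (starRingEnd ℂ κ), hm]
  module

theorem isTripotent_iff {S : SpinFactor X} {e : X} :
    S.IsTripotent e ↔ e = 0 ∨ S.IsRankOne e ∨ S.IsRankTwo e := by
  constructor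
  · intro h
    by_cases he : e = 0
    · exact Or.inl he
    · have h' : S.Q e e = e := h
      exact Or.inr (rank_of_Q_Q_self he (by rw [h', h']))
  · rintro (rfl | h | h)
    · exact S.Q_zero_right 0
    · exact h.Q_self
    · exact h.Q_self

/-- Tripotents are described by truncations of triple products. -/
theorem isTripotent_iff_isTruncation {S : SpinFactor X} {e : X} :
    S.IsTripotent e ↔ S.IsTruncation e (S.Q e e) := by
  constructor
  · intro h
    have h' : S.Q e e = e := h
    rw [h']; rfl
  · intro h
    by_cases he : e = 0
    · exact isTripotent_iff.2 (Or.inl he)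
    · exact isTripotent_iff.2 (Or.inr (rank_of_Q_Q_self he h))

theorem IsRankTwo.inner_conj_ne_zero {S : SpinFactor X} {u : X} (hu : S.IsRankTwo u) :
    inner ℂ (S.conj u) u ≠ (0 : ℂ) := by
  have h0 := hu.ne_zero
  obtain ⟨h1, κ, hκ⟩ := hu
  have hm := mul_conj_eq_one h0 hκ
  rw [hκ, inner_smul_left, h1, mul_one]
  exact right_ne_zero_of_mul_eq_one hm

theorem IsRankOne.not_isRankTwo {S : SpinFactor X} {e : X} (he : S.IsRankOne e) :
    ¬ S.IsRankTwo e := fun h => h.inner_conj_ne_zero he.1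

/-- If `Q(x)` is not injective, then `x` is isotropic. -/
theorem inner_conj_eq_zero_of_Q_eq_zero {S : SpinFactor X} {x y : X} (hy : y ≠ 0)
    (h : S.Q x y = 0) : inner ℂ (S.conj x) x = (0 : ℂ) := by
  by_contra hβ
  rw [Q_eq, sub_eq_zero] at h
  have h1 : inner ℂ y x * inner ℂ (S.conj x) x = 0 := by
    have h2 := congrArg (fun z => inner ℂ (S.conj x) z) h
    simp only [inner_smul_right, S.inner_conj_conj] at h2
    linear_combination h2
  have h3 := (mul_eq_zero.1 h1).resolve_right hβ
  rw [h3, mul_zero, zero_smul, eq_comm, smul_eq_zero] at h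
  rcases h with h | h
  · exact hβ h
  · exact hy (by rw [← S.conj_conj y, h, map_zero])

theorem eq_of_inner_eq_half {E : Type*} [NormedAddCommGroup E] [InnerProductSpace ℂ E] {e v : E} (he : inner ℂ e e = (2⁻¹ : ℂ))
    (hv : inner ℂ v v = (2⁻¹ : ℂ)) (h : inner ℂ e v = (2⁻¹ : ℂ)) : e = v := by
  have h' : inner ℂ v e = (2⁻¹ : ℂ) := by rw [← inner_conj_symm, h, conj_two_inv]
  have : inner ℂ (e - v) (e - v) = (0 : ℂ) := by
    simp only [inner_sub_left, inner_sub_right, he, hv, h, h']; norm_num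
  exact sub_eq_zero.1 (inner_self_eq_zero.1 this)

theorem IsRankOne.isTruncation_iff {S : SpinFactor X} {e : X} (he : S.IsRankOne e) (x : X) :
    S.IsTruncation e x ↔ inner ℂ e x = (2⁻¹ : ℂ) := by
  change S.Q e e = S.Q e x ↔ _
  rw [he.Q_self, he.Q_eq, ← inner_conj_symm e x]
  constructor
  · intro h
    have : (1 - 2 * inner ℂ x e) • e = 0 := by rw [sub_smul, one_smul, ← h, sub_self]
    have h2 := (smul_eq_zero.1 this).resolve_right he.ne_zero
    have h3 : inner ℂ x e = (2⁻¹ : ℂ) := by linear_combination -h2 / 2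
    rw [h3, conj_two_inv]
  · intro h
    have h3 := congrArg (starRingEnd ℂ) h
    rw [Complex.conj_conj] at h3
    rw [h3, conj_two_inv]; norm_num

/-- Rank-one tripotents are minimal for the truncation order. -/
theorem IsRankOne.eq_of_isTruncation {S : SpinFactor X} {e a : X} (he : S.IsRankOne e)
    (ha : S.IsTripotent a) (ha0 : a ≠ 0) (h : S.IsTruncation a e) : a = e := by
  rcases isTripotent_iff.1 ha with h0 | h1 | h2
  · exact absurd h0 ha0
  · exact eq_of_inner_eq_half h1.2 he.2 ((h1.isTruncation_iff e).1 h)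
  · exfalso
    have h' : S.Q a a = S.Q a e := h
    have hd : S.Q a (a - e) = 0 := by
      have : S.Q a (a - e) = S.Q a a - S.Q a e := by
        rw [S.Q_eq, S.Q_eq, S.Q_eq, inner_sub_left, map_sub]; module
      rw [this, h', sub_self]
    by_cases hae : a = e
    · exact he.not_isRankTwo (hae ▸ h2)
    · exact h2.inner_conj_ne_zero (inner_conj_eq_zero_of_Q_eq_zero (sub_ne_zero.2 hae) hd)

/-- The line spanned by a rank-one tripotent `e` is recognised by the kernels of the quadratic
operators: `Q(x)` is injective unless `x` is isotropic, and has kernel `x^⊥` if it is isotropic. -/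
theorem IsRankOne.mem_span_iff {S : SpinFactor X} {e : X} (he : S.IsRankOne e) (x : X) :
    x ∈ Submodule.span ℂ {e} ↔ ∀ y, S.Q e y = 0 → S.Q x y = 0 := by
  rw [Submodule.mem_span_singleton]
  constructor
  · rintro ⟨r, rfl⟩ y hy
    rw [Q_smul_left, hy, smul_zero]
  · intro h
    have h1 : S.Q x (S.conj e) = 0 := h _ ((he.Q_eq_zero_iff _).2 he.inner_conj)
    have hx := inner_conj_eq_zero_of_Q_eq_zero he.conj.ne_zero h1
    -- the component of `x` orthogonal to `e` lies in the kernel of `Q(e)`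
    set y := x - (2 * inner ℂ e x) • e with hy
    have hey : inner ℂ e y = (0 : ℂ) := by
      rw [hy, inner_sub_right, inner_smul_right, he.2]; ring
    have h2 := h y ((he.Q_eq_zero_iff _).2 hey)
    rw [S.Q_eq x y, hx, zero_smul, sub_zero, smul_eq_zero] at h2
    rcases h2 with h2 | h2
    · have h3 : inner ℂ y x = (0 : ℂ) := by simpa using h2
      have h4 : inner ℂ y y = (0 : ℂ) := by
        nth_rw 2 [hy]
        rw [inner_sub_right, inner_smul_right, h3, inner_eq_zero_symm.1 hey, mul_zero, sub_zero]
      exact ⟨_, (sub_eq_zero.1 (inner_self_eq_zero.1 h4)).symm⟩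
    · exact ⟨0, by rw [h2, zero_smul]⟩

theorem IsRankOne.add_smul_conj {S : SpinFactor X} {e : X} (he : S.IsRankOne e) {γ : ℂ}
    (hγ : ‖γ‖ = 1) : S.IsRankTwo (e + γ • S.conj e) := by
  have h1 : starRingEnd ℂ γ * γ = 1 := by rw [Complex.conj_mul', hγ]; simp
  refine ⟨?_, starRingEnd ℂ γ, ?_⟩
  · simp only [inner_add_left, inner_add_right, inner_smul_left, inner_smul_right, he.2,
      he.inner_conj, he.1, he.conj.2]
    linear_combination h1 / 2
  · rw [map_add, S.conj_smul, S.conj_conj, smul_add, smul_smul, h1, one_smul, add_comm]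

/-- A rank-one tripotent `v` is a multiple of the conjugate of `e` exactly if `Q(e)(v) = 0` and `e`,
`v` have a common upper bound among the tripotents. Such an upper bound has rank two, and the only
rank-one tripotent below it that is Hilbert orthogonal to `e` is its difference with `e`. -/
theorem IsRankOne.mem_span_conj_iff {S : SpinFactor X} {e v : X} (he : S.IsRankOne e)
    (hv : S.IsRankOne v) :
    v ∈ Submodule.span ℂ {S.conj e} ↔
      S.Q e v = 0 ∧ ∃ u, S.IsTripotent u ∧ S.IsTruncation e u ∧ S.IsTruncation v u := by
  rw [Submodule.mem_span_singleton]
  constructor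
  · rintro ⟨γ, rfl⟩
    have h1 : starRingEnd ℂ γ * γ = 1 := by
      have := hv.2
      rw [inner_smul_left, inner_smul_right, he.conj.2] at this
      linear_combination 2 * this
    have hγ : ‖γ‖ = 1 := by
      rw [Complex.conj_mul'] at h1
      have : ‖γ‖ ^ 2 = 1 := by exact_mod_cast h1
      nlinarith [norm_nonneg γ]
    refine ⟨?_, e + γ • S.conj e, isTripotent_iff.2 (Or.inr (Or.inr (he.add_smul_conj hγ))), ?_, ?_⟩
    · rw [he.Q_eq_zero_iff, inner_smul_right, he.inner_conj, mul_zero]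
    · rw [he.isTruncation_iff, inner_add_right, he.2, inner_smul_right, he.inner_conj]; simp
    · rw [hv.isTruncation_iff, inner_add_right, hv.2, inner_smul_left, he.1]; simp
  · rintro ⟨h0, u, hu, h1, h2⟩
    rw [he.Q_eq_zero_iff] at h0
    rw [he.isTruncation_iff] at h1
    rw [hv.isTruncation_iff] at h2
    have h1' : inner ℂ u e = (2⁻¹ : ℂ) := by rw [← inner_conj_symm, h1, conj_two_inv]
    have h2' : inner ℂ u v = (2⁻¹ : ℂ) := by rw [← inner_conj_symm, h2, conj_two_inv]
    have h0' : inner ℂ v e = (0 : ℂ) := by rw [← inner_conj_symm, h0]; simp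
    rcases isTripotent_iff.1 hu with h | h | h
    · rw [h, inner_zero_right] at h1; norm_num at h1
    · exfalso
      have e1 := eq_of_inner_eq_half he.2 h.2 h1
      have e2 := eq_of_inner_eq_half hv.2 h.2 h2
      rw [e1, e2, h.2] at h0; norm_num at h0
    · have hu0 := h.ne_zero
      obtain ⟨huu, κ, hκ⟩ := h
      have hm := mul_conj_eq_one hu0 hκ
      have k1 : inner ℂ (S.conj e) u = starRingEnd ℂ κ * 2⁻¹ := by
        rw [S.inner_conj_left, hκ, inner_smul_left, h1']
      have k2 : inner ℂ u (S.conj e) = κ * 2⁻¹ := by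
        rw [← inner_conj_symm, k1, map_mul, conj_two_inv, Complex.conj_conj]
      -- both `u - e - v` and `u - e - κ̄ ē` have norm zero
      have a1 : u - e - v = 0 := by
        rw [← inner_self_eq_zero (𝕜 := ℂ)]
        simp only [inner_sub_left, inner_sub_right, h1, h2, h1', h2', h0, h0', huu, he.2, hv.2]
        norm_num
      have a2 : u - e - starRingEnd ℂ κ • S.conj e = 0 := by
        rw [← inner_self_eq_zero (𝕜 := ℂ)]
        simp only [inner_sub_left, inner_sub_right, inner_smul_left, inner_smul_right, h1, h1', k1,
          k2, huu, he.2, he.1, he.inner_conj, he.conj.2, Complex.conj_conj]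
        linear_combination -hm / 2
      exact ⟨starRingEnd ℂ κ, by rw [← sub_eq_zero.1 a1, ← sub_eq_zero.1 a2]⟩

end SpinFactor

/-! ### Rank-one tripotents and their Peirce spaces -/

namespace SpinFactor

variable {X : Type*} [NormedAddCommGroup X] [InnerProductSpace ℂ X] [CompleteSpace X]

theorem conj_halfPlus (S : SpinFactor X) {a b : X} (ha : S.conj a = a) (hb : S.conj b = b) :
    S.conj (halfPlus a b) = halfMinus a b := by
  rw [halfPlus, halfMinus, conj_smul, map_add, conj_smul, ha, hb, conj_two_inv, Complex.conj_I,
    neg_smul, sub_eq_add_neg]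

theorem halfPlus_add_halfMinus {E : Type*} [AddCommGroup E] [Module ℂ E] (a b : E) :
    halfPlus a b + halfMinus a b = a := by
  rw [halfPlus, halfMinus]; module

theorem I_smul_halfMinus_sub_halfPlus {E : Type*} [AddCommGroup E] [Module ℂ E] (a b : E) :
    Complex.I • (halfMinus a b - halfPlus a b) = b := by
  have : Complex.I • (halfMinus a b - halfPlus a b) = (-(Complex.I * Complex.I)) • b := by
    rw [halfPlus, halfMinus]; module
  rw [this, Complex.I_mul_I, neg_neg, one_smul]

theorem realOrthonormal_pair_iff {S : SpinFactor X} {a b : X} :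
    S.RealOrthonormal ![a, b] ↔ S.conj a = a ∧ S.conj b = b ∧ inner ℂ a a = (1 : ℂ) ∧
      inner ℂ b b = (1 : ℂ) ∧ inner ℂ a b = (0 : ℂ) ∧ inner ℂ b a = (0 : ℂ) := by
  rw [RealOrthonormal, orthonormal_iff_ite]
  simp [Fin.forall_fin_two]
  tauto

theorem isRankOne_halfPlus {S : SpinFactor X} {a b : X} (h : S.RealOrthonormal ![a, b]) :
    S.IsRankOne (halfPlus a b) := by
  obtain ⟨ha, hb, haa, hbb, hab, hba⟩ := realOrthonormal_pair_iff.1 h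
  constructor
  · rw [S.conj_halfPlus ha hb, halfPlus, halfMinus]
    simp only [inner_smul_left, inner_smul_right, inner_sub_left, inner_add_right, haa, hbb, hab,
      hba, Complex.conj_I]
    linear_combination (starRingEnd ℂ) 2⁻¹ * 2⁻¹ * Complex.I_mul_I
  · rw [halfPlus]
    simp only [inner_smul_left, inner_smul_right, inner_add_left, inner_add_right, haa, hbb, hab,
      hba, Complex.conj_I, conj_two_inv]
    linear_combination -4⁻¹ * Complex.I_mul_I

/-- Rank-one tripotents are the elements `(a + ib)/2` with `a`, `b` real and orthonormal. -/
theorem IsRankOne.exists_halfPlus {S : SpinFactor X} {e : X} (he : S.IsRankOne e) :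
    ∃ a b : X, S.RealOrthonormal ![a, b] ∧ e = halfPlus a b := by
  refine ⟨e + S.conj e, Complex.I • (S.conj e - e), realOrthonormal_pair_iff.2
    ⟨?_, ?_, ?_, ?_, ?_, ?_⟩, ?_⟩
  · rw [map_add, S.conj_conj, add_comm]
  · rw [S.conj_smul, map_sub, S.conj_conj, Complex.conj_I]; module
  · simp only [inner_add_left, inner_add_right, he.1, he.2, he.inner_conj, he.conj.2]; norm_num
  · simp only [inner_smul_left, inner_smul_right, inner_sub_left, inner_sub_right, he.1, he.2,
      he.inner_conj, he.conj.2, Complex.conj_I]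
    linear_combination - Complex.I_mul_I
  · simp only [inner_smul_right, inner_sub_right, inner_add_left, he.1, he.2,
      he.inner_conj, he.conj.2]; norm_num
  · simp only [inner_smul_left, inner_sub_left, inner_add_right, he.1, he.2,
      he.inner_conj, he.conj.2]; norm_num
  · have : e = (2⁻¹ : ℂ) • ((1 - Complex.I * Complex.I) • e +
        (1 + Complex.I * Complex.I) • S.conj e) := by
      rw [Complex.I_mul_I]; module
    rw [halfPlus]
    nth_rw 1 [this]
    module

theorem halfPlus_injective {S : SpinFactor X} {a b c d : X} (h : S.RealOrthonormal ![a, b])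
    (h' : S.RealOrthonormal ![c, d]) (he : halfPlus a b = halfPlus c d) : a = c ∧ b = d := by
  obtain ⟨ha, hb, -⟩ := realOrthonormal_pair_iff.1 h
  obtain ⟨hc, hd, -⟩ := realOrthonormal_pair_iff.1 h'
  have hm : halfMinus a b = halfMinus c d := by
    rw [← S.conj_halfPlus ha hb, ← S.conj_halfPlus hc hd, he]
  constructor
  · rw [← halfPlus_add_halfMinus a b, he, hm, halfPlus_add_halfMinus]
  · rw [← I_smul_halfMinus_sub_halfPlus a b, he, hm, I_smul_halfMinus_sub_halfPlus]

theorem mem_hilbertPerp_pair {E : Type*} [NormedAddCommGroup E] [InnerProductSpace ℂ E]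
    {a b x : E} : x ∈ hilbertPerp {a, b} ↔ inner ℂ a x = (0 : ℂ) ∧ inner ℂ b x = (0 : ℂ) := by
  rw [hilbertPerp, Submodule.mem_orthogonal]
  constructor
  · intro h
    exact ⟨h a (Submodule.subset_span (by simp)), h b (Submodule.subset_span (by simp))⟩
  · rintro ⟨h1, h2⟩ u hu
    obtain ⟨r, s, rfl⟩ := Submodule.mem_span_pair.1 hu
    rw [inner_add_left, inner_smul_left, inner_smul_left, h1, h2, mul_zero, mul_zero, add_zero]

theorem hilbertPerp_half {E : Type*} [NormedAddCommGroup E] [InnerProductSpace ℂ E] (a b : E) :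
    hilbertPerp {halfPlus a b, halfMinus a b} = hilbertPerp {a, b} := by
  ext x
  rw [mem_hilbertPerp_pair, mem_hilbertPerp_pair]
  constructor
  · rintro ⟨h1, h2⟩
    constructor
    · rw [← halfPlus_add_halfMinus a b, inner_add_left, h1, h2, add_zero]
    · rw [← I_smul_halfMinus_sub_halfPlus a b, inner_smul_left, inner_sub_left, h1, h2, sub_zero,
        mul_zero]
  · rintro ⟨h1, h2⟩
    constructor
    · rw [halfPlus, inner_smul_left, inner_add_left, inner_smul_left, h1, h2]; simp
    · rw [halfMinus, inner_smul_left, inner_sub_left, inner_smul_left, h1, h2]; simp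

theorem mem_peirce (S : SpinFactor X) (j : ℕ) (e x : X) :
    x ∈ S.peirce j e ↔ inner ℂ e e • x + inner ℂ e x • e - inner ℂ (S.conj x) e • S.conj e =
      ((j : ℂ) / 2) • x := by
  rw [peirce, Module.End.mem_eigenspace_iff]
  rfl

theorem IsRankOne.mem_peirce {S : SpinFactor X} {e : X} (he : S.IsRankOne e) (j : ℕ) (x : X) :
    x ∈ S.peirce j e ↔
      inner ℂ e x • e - inner ℂ (S.conj e) x • S.conj e = (((j : ℂ) - 1) / 2) • x := by
  rw [SpinFactor.mem_peirce, he.2, S.inner_conj_left x e, ← sub_eq_zero,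
    ← sub_eq_zero (a := inner ℂ e x • e - inner ℂ (S.conj e) x • S.conj e)]
  constructor <;> intro h <;> rw [← h] <;> module

/-- The inner products with `e` and with its conjugate of the defining equation of the Peirce
spaces. -/
theorem IsRankOne.inner_of_mem_peirce {S : SpinFactor X} {e x : X} (he : S.IsRankOne e) {j : ℕ}
    (h : x ∈ S.peirce j e) : ((j : ℂ) - 2) * inner ℂ e x = 0 ∧ (j : ℂ) * inner ℂ (S.conj e) x = 0 := by
  rw [he.mem_peirce] at h
  constructor
  · have h1 := congrArg (fun z => inner ℂ e z) h
    simp only [inner_sub_right, inner_smul_right, he.2, he.inner_conj] at h1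
    linear_combination -2 * h1
  · have h1 := congrArg (fun z => inner ℂ (S.conj e) z) h
    simp only [inner_sub_right, inner_smul_right, he.1, he.conj.2] at h1
    linear_combination -2 * h1

theorem IsRankOne.peirce_one {S : SpinFactor X} {e : X} (he : S.IsRankOne e) :
    S.peirce 1 e = hilbertPerp {e, S.conj e} := by
  ext x
  rw [mem_hilbertPerp_pair]
  constructor
  · intro h
    obtain ⟨h1, h2⟩ := he.inner_of_mem_peirce h
    norm_num at h1 h2
    exact ⟨h1, h2⟩
  · rintro ⟨h1, h2⟩
    rw [he.mem_peirce, h1, h2]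
    simp

theorem IsRankOne.peirce_zero {S : SpinFactor X} {e : X} (he : S.IsRankOne e) :
    S.peirce 0 e = Submodule.span ℂ {S.conj e} := by
  ext x
  rw [Submodule.mem_span_singleton]
  constructor
  · intro h
    have h1 := (he.inner_of_mem_peirce h).1
    norm_num at h1
    rw [he.mem_peirce, h1] at h
    refine ⟨2 * inner ℂ (S.conj e) x, ?_⟩
    have h2 := congrArg (fun z => (-2 : ℂ) • z) h
    simp only [zero_smul, zero_sub, smul_neg, smul_smul] at h2
    norm_num at h2
    exact h2
  · rintro ⟨r, rfl⟩
    rw [he.mem_peirce, inner_smul_right, inner_smul_right, he.inner_conj, he.conj.2]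
    push_cast
    module

theorem IsRankOne.peirce_two {S : SpinFactor X} {e : X} (he : S.IsRankOne e) :
    S.peirce 2 e = Submodule.span ℂ {e} := by
  ext x
  rw [Submodule.mem_span_singleton]
  constructor
  · intro h
    have h1 := (he.inner_of_mem_peirce h).2
    norm_num at h1
    rw [he.mem_peirce, h1] at h
    refine ⟨2 * inner ℂ e x, ?_⟩
    have h2 := congrArg (fun z => (2 : ℂ) • z) h
    simp only [zero_smul, sub_zero, smul_smul] at h2
    norm_num at h2
    exact h2
  · rintro ⟨r, rfl⟩
    rw [he.mem_peirce, inner_smul_right, inner_smul_right, he.1, he.2]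
    push_cast
    module

theorem IsRankOne.peirce_one_sup_peirce_zero {S : SpinFactor X} {e : X} (he : S.IsRankOne e)
    (x : X) : x ∈ S.peirce 1 e ⊔ S.peirce 0 e ↔ inner ℂ e x = (0 : ℂ) := by
  rw [he.peirce_one, he.peirce_zero, Submodule.mem_sup]
  constructor
  · rintro ⟨y, hy, z, hz, rfl⟩
    obtain ⟨r, rfl⟩ := Submodule.mem_span_singleton.1 hz
    rw [inner_add_right, (mem_hilbertPerp_pair.1 hy).1, inner_smul_right, he.inner_conj]
    simp
  · intro h
    refine ⟨x - (2 * inner ℂ (S.conj e) x) • S.conj e, mem_hilbertPerp_pair.2 ⟨?_, ?_⟩,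
      (2 * inner ℂ (S.conj e) x) • S.conj e, Submodule.smul_mem _ _
        (Submodule.mem_span_singleton_self _), by abel⟩
    · rw [inner_sub_right, h, inner_smul_right, he.inner_conj]; simp
    · rw [inner_sub_right, inner_smul_right, he.conj.2]; ring

theorem IsRankOne.disjoint {S : SpinFactor X} {e : X} (he : S.IsRankOne e) :
    Disjoint (hilbertPerp {e, S.conj e}) (Submodule.span ℂ {S.conj e}) := by
  rw [Submodule.disjoint_def]
  intro x h1 h2
  obtain ⟨r, rfl⟩ := Submodule.mem_span_singleton.1 h2
  have h3 := (mem_hilbertPerp_pair.1 h1).2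
  rw [inner_smul_right, he.conj.2] at h3
  have : r = 0 := by linear_combination 2 * h3
  rw [this, zero_smul]

theorem isMinimalTripotent_iff {S : SpinFactor X} {e : X} :
    S.IsMinimalTripotent e ↔ S.IsRankOne e := by
  constructor
  · rintro ⟨h1, h2, h3⟩
    rcases isTripotent_iff.1 h1 with h | h | h
    · exact absurd h h3
    · exact h
    · exfalso
      obtain ⟨huu, κ, hκ⟩ := h
      have hm := mul_conj_eq_one h3 hκ
      have htop : S.peirce 2 e = ⊤ := by
        refine eq_top_iff.2 fun x _ => ?_
        rw [S.mem_peirce, huu, S.inner_conj_left, hκ, inner_smul_left, smul_smul,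
          mul_right_comm, mul_comm (starRingEnd ℂ κ), hm]
        push_cast
        module
      have h4 : Module.rank ℂ X ≤ 1 := by
        rw [← rank_top ℂ X, ← htop, h2]
        exact (rank_span_le _).trans (by simp)
      exact absurd (S.three_le_rank.trans h4) (by norm_num)
  · intro h
    exact ⟨h.Q_self, h.peirce_two, h.ne_zero⟩

end SpinFactor

/-! ### What a bijection that preserves truncations preserves -/

namespace PreservesTruncations

open SpinFactor

variable {X Y : Type*} [NormedAddCommGroup X] [InnerProductSpace ℂ X] [CompleteSpace X]
  [NormedAddCommGroup Y] [InnerProductSpace ℂ Y] [CompleteSpace Y]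
  {S : SpinFactor X} {T : SpinFactor Y} {Δ : X ≃ Y}

theorem symm (h : PreservesTruncations S T Δ) : PreservesTruncations T S Δ.symm := by
  intro a b c
  rw [h, Δ.apply_symm_apply, Δ.apply_symm_apply, Δ.apply_symm_apply]

theorem map_zero (h : PreservesTruncations S T Δ) : Δ 0 = 0 := by
  -- zero is the only truncation of zero
  have h1 : T.IsTruncation (Δ 0) (T.Q (Δ 0) (Δ (Δ.symm 0))) := by
    rw [← h, S.Q_zero_left]; rfl
  rw [Δ.apply_symm_apply, T.Q_zero_right] at h1
  exact T.eq_zero_of_Q_self (h1.trans (T.Q_zero_right _))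

theorem map_eq_zero_iff (h : PreservesTruncations S T Δ) {x : X} : Δ x = 0 ↔ x = 0 := by
  rw [← h.map_zero, Δ.apply_eq_iff_eq]

theorem Q_map_eq_zero_of_Q_eq_zero (h : PreservesTruncations S T Δ) {b c : X}
    (hbc : S.Q b c = 0) : T.Q (Δ b) (Δ c) = 0 := by
  -- an element is a truncation of itself
  have h1 : T.IsTruncation (Δ (Δ.symm (T.Q (Δ b) (Δ c)))) (T.Q (Δ b) (Δ c)) := by
    rw [Δ.apply_symm_apply]; rfl
  rw [← h, hbc] at h1
  have h2 := S.eq_zero_of_Q_self (h1.trans (S.Q_zero_right _))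
  rwa [h.symm.map_eq_zero_iff] at h2

theorem Q_map_eq_zero_iff (h : PreservesTruncations S T Δ) {b c : X} :
    T.Q (Δ b) (Δ c) = 0 ↔ S.Q b c = 0 := by
  refine ⟨fun h1 => ?_, h.Q_map_eq_zero_of_Q_eq_zero⟩
  simpa using h.symm.Q_map_eq_zero_of_Q_eq_zero h1

theorem isTripotent_iff (h : PreservesTruncations S T Δ) {x : X} :
    T.IsTripotent (Δ x) ↔ S.IsTripotent x := by
  rw [isTripotent_iff_isTruncation, isTripotent_iff_isTruncation, h]

theorem isTruncation_iff (h : PreservesTruncations S T Δ) {x u : X} (hu : S.IsTripotent u) :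
    T.IsTruncation (Δ x) (Δ u) ↔ S.IsTruncation x u := by
  have h1 : S.Q u u = u := hu
  have h2 : T.Q (Δ u) (Δ u) = Δ u := h.isTripotent_iff.2 hu
  have := h x u u
  rw [h1, h2] at this
  exact this.symm

end PreservesTruncations

/-! ### Real vectors, and the separation of lines by rank-one tripotents -/

namespace SpinFactor

variable {X : Type*} [NormedAddCommGroup X] [InnerProductSpace ℂ X] [CompleteSpace X]

theorem inner_eq_zero_iff_of_mem_span {E : Type*} [NormedAddCommGroup E] [InnerProductSpace ℂ E]
    {g z : E} (hg : g ≠ 0) (hz : z ∈ Submodule.span ℂ {g}) : inner ℂ g z = (0 : ℂ) ↔ z = 0 := by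
  obtain ⟨r, rfl⟩ := Submodule.mem_span_singleton.1 hz
  simp [hg]

/-- Every nonzero vector and its conjugate together span a real unit vector. -/
theorem exists_real_mem_span (S : SpinFactor X) {z : X} (hz : z ≠ 0) :
    ∃ d, S.conj d = d ∧ inner ℂ d d = (1 : ℂ) ∧ d ∈ Submodule.span ℂ {z, S.conj z} := by
  -- the real or the imaginary part of `z` is nonzero
  obtain ⟨w, hw, hw0, hws⟩ : ∃ w, S.conj w = w ∧ w ≠ 0 ∧ w ∈ Submodule.span ℂ {z, S.conj z} := by
    by_cases h : z + S.conj z = 0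
    · refine ⟨Complex.I • z, ?_, smul_ne_zero Complex.I_ne_zero hz,
        Submodule.smul_mem _ _ (Submodule.subset_span (by simp))⟩
      rw [S.conj_smul, eq_neg_of_add_eq_zero_right h, Complex.conj_I]; module
    · exact ⟨z + S.conj z, by rw [map_add, S.conj_conj, add_comm], h,
        Submodule.add_mem _ (Submodule.subset_span (by simp)) (Submodule.subset_span (by simp))⟩
  have hn : (‖w‖ : ℂ) ≠ 0 := by exact_mod_cast norm_ne_zero_iff.2 hw0
  refine ⟨((‖w‖ : ℂ)⁻¹) • w, ?_, ?_, Submodule.smul_mem _ _ hws⟩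
  · rw [S.conj_smul, hw, map_inv₀, Complex.conj_ofReal]
  · rw [inner_smul_left, inner_smul_right, map_inv₀, Complex.conj_ofReal,
      inner_self_eq_norm_sq_to_K]
    simp only [Complex.coe_algebraMap]
    field_simp

/-- A finite family that is invariant under the conjugation and too small to span has a real unit
vector in its orthogonal complement. -/
theorem exists_real_orthogonal (S : SpinFactor X) {n : ℕ} (w : Fin n → X)
    (hw : ∀ i, ∃ j, S.conj (w i) = w j) (hn : (n : Cardinal) < Module.rank ℂ X) :
    ∃ d, S.conj d = d ∧ inner ℂ d d = (1 : ℂ) ∧ ∀ i, inner ℂ (w i) d = (0 : ℂ) := by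
  have hfd : FiniteDimensional ℂ (Submodule.span ℂ (Set.range w)) :=
    FiniteDimensional.span_of_finite ℂ (Set.finite_range w)
  have hne : Submodule.span ℂ (Set.range w) ≠ ⊤ := by
    intro h
    have h1 : Module.rank ℂ (Submodule.span ℂ (Set.range w)) ≤ n :=
      (rank_span_le _).trans (by simpa using Cardinal.mk_range_le_lift (f := w))
    rw [h, rank_top] at h1
    exact absurd hn (not_lt.2 h1)
  obtain ⟨z, hz, hz0⟩ := Submodule.exists_mem_ne_zero_of_ne_bot
    (fun h => hne ((Submodule.orthogonal_eq_bot_iff).1 h))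
  rw [Submodule.mem_orthogonal] at hz
  obtain ⟨d, hd, hdd, hds⟩ := S.exists_real_mem_span hz0
  obtain ⟨r, s, rfl⟩ := Submodule.mem_span_pair.1 hds
  refine ⟨_, hd, hdd, fun i => ?_⟩
  obtain ⟨j, hj⟩ := hw i
  have h1 : inner ℂ (w i) z = (0 : ℂ) := hz _ (Submodule.subset_span ⟨i, rfl⟩)
  have h2 : inner ℂ (w j) z = (0 : ℂ) := hz _ (Submodule.subset_span ⟨j, rfl⟩)
  rw [inner_add_right, inner_smul_right, inner_smul_right, h1, S.inner_conj_right, hj,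
    inner_eq_zero_symm.1 h2]
  simp

theorem realOrthonormal_cons_iff {S : SpinFactor X} {n : ℕ} {d : X} {v : Fin n → X} :
    S.RealOrthonormal (Matrix.vecCons d v) ↔ S.conj d = d ∧ inner ℂ d d = (1 : ℂ) ∧
      (∀ i, inner ℂ (v i) d = (0 : ℂ)) ∧ S.RealOrthonormal v := by
  simp only [RealOrthonormal, orthonormal_iff_ite, Fin.forall_fin_succ, Matrix.cons_val_zero,
    Matrix.cons_val_succ]
  constructor
  · rintro ⟨⟨h1, h2⟩, ⟨h3, h4⟩, h5⟩
    refine ⟨h1, by simpa using h3, fun i => ?_, h2, fun i j => ?_⟩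
    · simpa using (h5 i).1
    · simpa using (h5 i).2 j
  · rintro ⟨h1, h2, h3, h4, h5⟩
    refine ⟨⟨h1, h4⟩, ⟨by simpa using h2, fun i => ?_⟩, fun i => ⟨?_, fun j => ?_⟩⟩
    · simpa [Fin.succ_ne_zero, eq_comm] using inner_eq_zero_symm.1 (h3 i)
    · simpa using h3 i
    · simpa using h5 i j

theorem realOrthonormal_triple_iff {S : SpinFactor X} {a b c : X} :
    S.RealOrthonormal ![a, b, c] ↔ S.RealOrthonormal ![a, b] ∧ S.conj c = c ∧
      inner ℂ c c = (1 : ℂ) ∧ inner ℂ a c = (0 : ℂ) ∧ inner ℂ b c = (0 : ℂ) := by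
  simp only [realOrthonormal_cons_iff, Fin.forall_fin_succ, Matrix.cons_val_zero,
    Matrix.cons_val_succ, inner_eq_zero_symm (x := c)]
  simp
  tauto

theorem realOrthonormal_quadruple_iff {S : SpinFactor X} {a b c d : X} :
    S.RealOrthonormal ![a, b, c, d] ↔ S.RealOrthonormal ![a, b, c] ∧ S.conj d = d ∧
      inner ℂ d d = (1 : ℂ) ∧ inner ℂ a d = (0 : ℂ) ∧ inner ℂ b d = (0 : ℂ) ∧
      inner ℂ c d = (0 : ℂ) := by
  simp only [realOrthonormal_cons_iff, Fin.forall_fin_succ, Matrix.cons_val_zero,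
    Matrix.cons_val_succ, inner_eq_zero_symm (x := d)]
  simp
  tauto

theorem RealOrthonormal.le_rank {S : SpinFactor X} {n : ℕ} {v : Fin n → X}
    (hv : S.RealOrthonormal v) : (n : Cardinal) ≤ Module.rank ℂ X := by
  simpa using hv.2.linearIndependent.cardinal_lift_le_rank

/-- Rank-two tripotents are not minimal for the truncation order. -/
theorem IsRankTwo.exists_isTruncation {S : SpinFactor X} {u : X} (hu : S.IsRankTwo u) :
    ∃ a, S.IsRankOne a ∧ S.IsTruncation a u := by
  obtain ⟨γ, x, hγ, hx, hn, rfl⟩ := hu.exists_real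
  obtain ⟨b, hb, hbb, hxb⟩ := S.exists_real_orthogonal ![x] (by simp [hx])
    (lt_of_lt_of_le (by norm_num) S.three_le_rank)
  have hxx : inner ℂ x x = (1 : ℂ) := by rw [inner_self_eq_norm_sq_to_K, hn]; simp
  have hxb' : inner ℂ x b = (0 : ℂ) := by simpa using hxb
  have ho : S.RealOrthonormal ![x, b] := realOrthonormal_pair_iff.2
    ⟨hx, hb, hxx, hbb, hxb', inner_eq_zero_symm.1 hxb'⟩
  have h1 : starRingEnd ℂ γ * γ = 1 := by rw [Complex.conj_mul', hγ]; simp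
  have ha := (isRankOne_halfPlus ho).smul hγ
  refine ⟨γ • halfPlus x b, ha, (ha.isTruncation_iff _).2 ?_⟩
  rw [inner_smul_left, inner_smul_right, ← mul_assoc, h1, halfPlus, inner_smul_left, inner_add_left,
    inner_smul_left, inner_eq_zero_symm.1 hxb', hxx, conj_two_inv]
  ring

theorem exists_smul_isRankOne {S : SpinFactor X} {a : X} (ha : a ≠ 0)
    (h : inner ℂ (S.conj a) a = (0 : ℂ)) : ∃ s : ℂ, s ≠ 0 ∧ S.IsRankOne (s • a) := by
  have hn : Real.sqrt 2 * ‖a‖ ≠ 0 := mul_ne_zero (by positivity) (norm_ne_zero_iff.2 ha)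
  refine ⟨((Real.sqrt 2 * ‖a‖)⁻¹ : ℝ), by exact_mod_cast inv_ne_zero hn, ?_, ?_⟩
  · rw [S.conj_smul, inner_smul_left, inner_smul_right, h]; simp
  · rw [inner_smul_left, inner_smul_right, Complex.conj_ofReal, inner_self_eq_norm_sq_to_K]
    have : (Real.sqrt 2 * ‖a‖)⁻¹ * ((Real.sqrt 2 * ‖a‖)⁻¹ * ‖a‖ ^ 2) = 2⁻¹ := by
      have h2 : Real.sqrt 2 ^ 2 = 2 := Real.sq_sqrt (by norm_num)
      have h3 : ‖a‖ ≠ 0 := norm_ne_zero_iff.2 ha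
      field_simp
      exact h2.symm
    have h4 : (((Real.sqrt 2 * ‖a‖)⁻¹ * ((Real.sqrt 2 * ‖a‖)⁻¹ * ‖a‖ ^ 2) : ℝ) : ℂ) = 2⁻¹ := by
      rw [this]; simp
    rw [← h4]
    simp only [Complex.coe_algebraMap]
    push_cast
    ring

/-- An element `z` is not orthogonal to a rank-one tripotent `e` exactly if some nonzero multiple
of `e` is a truncation of `z`. -/
theorem IsRankOne.inner_ne_zero_iff {S : SpinFactor X} {e : X} (he : S.IsRankOne e) (z : X) :
    inner ℂ e z ≠ (0 : ℂ) ↔ ∃ a ∈ Submodule.span ℂ {e}, a ≠ 0 ∧ S.IsTruncation a z := by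
  have key : ∀ α : ℂ, S.IsTruncation (α • e) z ↔
      (α * α * (starRingEnd ℂ α - 2 * inner ℂ z e)) • e = 0 := by
    intro α
    change S.Q (α • e) (α • e) = S.Q (α • e) z ↔ _
    rw [Q_smul_left, Q_smul_left, Q_smul_right, he.Q_self, he.Q_eq, ← sub_eq_zero]
    constructor <;> intro h <;> rw [← h] <;> module
  constructor
  · intro h
    refine ⟨(2 * inner ℂ e z) • e, Submodule.smul_mem _ _ (Submodule.mem_span_singleton_self _),
      smul_ne_zero (mul_ne_zero two_ne_zero h) he.ne_zero, (key _).2 ?_⟩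
    rw [map_mul, inner_conj_symm, Complex.conj_ofNat, sub_self, mul_zero, zero_smul]
  · rintro ⟨a, ha, ha0, h⟩ h0
    obtain ⟨α, rfl⟩ := Submodule.mem_span_singleton.1 ha
    rw [key, inner_eq_zero_symm.1 h0, mul_zero, sub_zero] at h
    have hα : α ≠ 0 := fun h1 => ha0 (by rw [h1, zero_smul])
    simp [hα, he.ne_zero] at h

/-- In dimension at least four, the rank-one tripotents separate a vector from a line spanned by a
rank-two tripotent. -/
theorem IsRankTwo.exists_isRankOne {S : SpinFactor X} (h4 : 4 ≤ Module.rank ℂ X) {g z : X}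
    (hg : S.IsRankTwo g) (hz : z ∉ Submodule.span ℂ {g}) :
    ∃ a, S.IsRankOne a ∧ inner ℂ a z = (0 : ℂ) ∧ inner ℂ a g ≠ (0 : ℂ) := by
  obtain ⟨γ, x, hγ, hx, hn, rfl⟩ := hg.exists_real
  have hγ0 : γ ≠ 0 := by rintro rfl; simp at hγ
  have hxx : inner ℂ x x = (1 : ℂ) := by rw [inner_self_eq_norm_sq_to_K, hn]; simp
  obtain ⟨r, hr, hrr, hr'⟩ := S.exists_real_orthogonal ![x, z, S.conj z]
    (by
      intro i
      fin_cases i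
      · exact ⟨0, by simp [hx]⟩
      · exact ⟨2, by simp⟩
      · exact ⟨1, by simp [S.conj_conj]⟩)
    (lt_of_lt_of_le (by norm_num) h4)
  have hxr : inner ℂ x r = (0 : ℂ) := hr' 0
  have hzr : inner ℂ z r = (0 : ℂ) := hr' 1
  set y := z - inner ℂ x z • x with hy
  have hxy : inner ℂ x y = (0 : ℂ) := by
    rw [hy, inner_sub_right, inner_smul_right, hxx]; ring
  have hy0 : y ≠ 0 := by
    intro h
    refine hz (Submodule.mem_span_singleton.2 ⟨inner ℂ x z * γ⁻¹, ?_⟩)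
    rw [smul_smul, inv_mul_cancel_right₀ hγ0, ← sub_eq_zero.1 h]
  have hzy : inner ℂ z y ≠ (0 : ℂ) := by
    have : z = y + inner ℂ x z • x := by rw [hy]; abel
    rw [this, inner_add_left, inner_smul_left, hxy, mul_zero, add_zero]
    exact inner_self_ne_zero.2 hy0
  have hry : inner ℂ r y = (0 : ℂ) := by
    rw [hy, inner_sub_right, inner_smul_right, inner_eq_zero_symm.1 hxr, inner_eq_zero_symm.1 hzr]
    ring
  -- `h` is orthogonal to `z` and not to `x`; a multiple of `r` makes it isotropic
  set h := x - (inner ℂ z x / inner ℂ z y) • y with hh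
  have hzh : inner ℂ z h = (0 : ℂ) := by
    rw [hh, inner_sub_right, inner_smul_right]; field_simp; ring
  have hxh : inner ℂ x h = (1 : ℂ) := by
    rw [hh, inner_sub_right, inner_smul_right, hxy, hxx]; ring
  have hrh : inner ℂ r h = (0 : ℂ) := by
    rw [hh, inner_sub_right, inner_smul_right, hry, inner_eq_zero_symm.1 hxr]; ring
  obtain ⟨t, ht⟩ := IsAlgClosed.exists_pow_nat_eq (-inner ℂ (S.conj h) h) (n := 2) two_pos
  have hxa : inner ℂ x (h + t • r) = (1 : ℂ) := by
    rw [inner_add_right, inner_smul_right, hxr, hxh]; ring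
  have ha0 : h + t • r ≠ 0 := by
    intro h0
    rw [h0, inner_zero_right] at hxa
    exact zero_ne_one hxa
  have hB : inner ℂ (S.conj (h + t • r)) (h + t • r) = (0 : ℂ) := by
    have h1 : inner ℂ (S.conj h) r = (0 : ℂ) := by rw [S.inner_conj_left, hr, hrh]
    rw [map_add, S.conj_smul, hr]
    simp only [inner_add_left, inner_add_right, inner_smul_left, inner_smul_right, h1, hrh, hrr,
      Complex.conj_conj]
    linear_combination ht
  obtain ⟨s, hs, hsa⟩ := exists_smul_isRankOne ha0 hB
  refine ⟨_, hsa, inner_eq_zero_symm.1 ?_, fun h1 => ?_⟩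
  · rw [inner_smul_right, inner_add_right, inner_smul_right, hzh, hzr]; ring
  · have h2 := inner_eq_zero_symm.1 h1
    rw [inner_smul_left, inner_smul_right, hxa] at h2
    simp [hγ0, hs] at h2

theorem IsRankTwo.mem_span_iff {S : SpinFactor X} (h4 : 4 ≤ Module.rank ℂ X) {g : X}
    (hg : S.IsRankTwo g) (z : X) : z ∈ Submodule.span ℂ {g} ↔
      z = 0 ∨ ∀ a, S.IsRankOne a → inner ℂ a z = (0 : ℂ) → inner ℂ a g = (0 : ℂ) := by
  constructor
  · intro h
    by_cases hz : z = 0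
    · exact Or.inl hz
    · right
      obtain ⟨r, rfl⟩ := Submodule.mem_span_singleton.1 h
      intro a _ h1
      rw [inner_smul_right] at h1
      refine (mul_eq_zero.1 h1).resolve_left ?_
      rintro rfl
      simp at hz
  · rintro (rfl | h)
    · exact Submodule.zero_mem _
    · by_contra hz
      obtain ⟨a, ha, h1, h2⟩ := hg.exists_isRankOne h4 hz
      exact h2 (h a ha h1)

/-- In dimension at least four, orthogonality to a rank-two tripotent `g` is detected, up to the
multiples of `g`, by the rank-one tripotents orthogonal to `x̄` and to `Q(g)(x)`. The reason is that
`Q(g)(x)` is a combination of `g` and `x̄` in which `g` has the coefficient `2⟨g|x⟩`. -/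
theorem IsRankTwo.inner_eq_zero_or_mem_span_iff {S : SpinFactor X} (h4 : 4 ≤ Module.rank ℂ X)
    {g : X} (hg : S.IsRankTwo g) (x : X) :
    (inner ℂ g x = (0 : ℂ) ∨ x ∈ Submodule.span ℂ {g}) ↔
      ∀ a, S.IsRankOne a → inner ℂ a (S.conj x) = (0 : ℂ) → inner ℂ a (S.Q g x) = (0 : ℂ) := by
  have hg0 := hg.ne_zero
  obtain ⟨hgg, κ, hκ⟩ := id hg
  have hm := mul_conj_eq_one hg0 hκ
  have hκ0 : κ ≠ 0 := left_ne_zero_of_mul_eq_one hm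
  have key : ∀ a, inner ℂ a (S.conj x) = (0 : ℂ) →
      inner ℂ a (S.Q g x) = 2 * inner ℂ x g * inner ℂ a g := by
    intro a ha
    rw [IsRankTwo.Q_eq hgg hκ, inner_sub_right, inner_smul_right, inner_smul_right, ha]; ring
  constructor
  · rintro (h | h) a _ h1
    · rw [key a h1, inner_eq_zero_symm.1 h]; ring
    · obtain ⟨r, rfl⟩ := Submodule.mem_span_singleton.1 h
      rw [key _ h1, inner_smul_left, hgg]
      rw [S.conj_smul, hκ, inner_smul_right, inner_smul_right] at h1
      have h2 : starRingEnd ℂ r * inner ℂ a g = 0 := by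
        have : κ * (starRingEnd ℂ r * inner ℂ a g) = 0 := by linear_combination h1
        exact (mul_eq_zero.1 this).resolve_left hκ0
      linear_combination 2 * h2
  · intro h
    by_contra! hc
    have hz : S.conj x ∉ Submodule.span ℂ {g} := by
      intro h1
      obtain ⟨r, hr⟩ := Submodule.mem_span_singleton.1 h1
      refine hc.2 (Submodule.mem_span_singleton.2 ⟨starRingEnd ℂ r * κ, ?_⟩)
      rw [← S.conj_conj x, ← hr, S.conj_smul, hκ, smul_smul]
    obtain ⟨a, ha, h1, h2⟩ := hg.exists_isRankOne h4 hz
    have h3 := h a ha h1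
    rw [key a h1] at h3
    have h5 : inner ℂ x g ≠ (0 : ℂ) := fun h6 => hc.1 (inner_eq_zero_symm.1 h6)
    simp [h5, h2] at h3

end SpinFactor

/-! ### Orthogonality is preserved -/

namespace PreservesTruncations

open SpinFactor

variable {X Y : Type*} [NormedAddCommGroup X] [InnerProductSpace ℂ X] [CompleteSpace X]
  [NormedAddCommGroup Y] [InnerProductSpace ℂ Y] [CompleteSpace Y]
  {S : SpinFactor X} {T : SpinFactor Y} {Δ : X ≃ Y}

/-- Rank-one tripotents are the minimal nonzero tripotents in the truncation order. -/
theorem isRankOne_map (h : PreservesTruncations S T Δ) {e : X} (he : S.IsRankOne e) :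
    T.IsRankOne (Δ e) := by
  have het : S.IsTripotent e := SpinFactor.isTripotent_iff.2 (Or.inr (Or.inl he))
  rcases SpinFactor.isTripotent_iff.1 (h.isTripotent_iff.2 het) with h0 | h1 | h2
  · exact absurd (h.map_eq_zero_iff.1 h0) he.ne_zero
  · exact h1
  · obtain ⟨a, ha, hau⟩ := h2.exists_isTruncation
    obtain ⟨a, rfl⟩ := Δ.surjective a
    rw [h.isTruncation_iff het] at hau
    have hat := h.isTripotent_iff.1 (SpinFactor.isTripotent_iff.2 (Or.inr (Or.inl ha)))
    have ha0 : a ≠ 0 := fun h3 => ha.ne_zero (h.map_eq_zero_iff.2 h3)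
    rwa [he.eq_of_isTruncation hat ha0 hau] at ha

theorem isRankOne_map_iff (h : PreservesTruncations S T Δ) {e : X} :
    T.IsRankOne (Δ e) ↔ S.IsRankOne e :=
  ⟨fun h1 => by simpa using h.symm.isRankOne_map h1, h.isRankOne_map⟩

theorem isRankTwo_map (h : PreservesTruncations S T Δ) {u : X} (hu : S.IsRankTwo u) :
    T.IsRankTwo (Δ u) := by
  have hut : S.IsTripotent u := SpinFactor.isTripotent_iff.2 (Or.inr (Or.inr hu))
  rcases SpinFactor.isTripotent_iff.1 (h.isTripotent_iff.2 hut) with h0 | h1 | h2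
  · exact absurd (h.map_eq_zero_iff.1 h0) hu.ne_zero
  · exact absurd hu (h.isRankOne_map_iff.1 h1).not_isRankTwo
  · exact h2

theorem inner_map_eq_zero_iff (h : PreservesTruncations S T Δ) {e : X} (he : S.IsRankOne e)
    (x : X) : inner ℂ (Δ e) (Δ x) = (0 : ℂ) ↔ inner ℂ e x = (0 : ℂ) := by
  rw [← he.Q_eq_zero_iff, ← (h.isRankOne_map he).Q_eq_zero_iff, h.Q_map_eq_zero_iff]

theorem map_mem_span_iff (h : PreservesTruncations S T Δ) {e : X} (he : S.IsRankOne e) {x : X} :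
    Δ x ∈ Submodule.span ℂ {Δ e} ↔ x ∈ Submodule.span ℂ {e} := by
  rw [he.mem_span_iff, (h.isRankOne_map he).mem_span_iff, ← Δ.forall_congr_right]
  simp only [h.Q_map_eq_zero_iff]

/-- The conjugation is preserved up to scalars on rank-one tripotents. -/
theorem map_conj_mem_span (h : PreservesTruncations S T Δ) {e : X} (he : S.IsRankOne e) :
    Δ (S.conj e) ∈ Submodule.span ℂ {T.conj (Δ e)} := by
  obtain ⟨h1, u, hu, heu, hvu⟩ :=
    (he.mem_span_conj_iff he.conj).1 (Submodule.mem_span_singleton_self _)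
  exact ((h.isRankOne_map he).mem_span_conj_iff (h.isRankOne_map he.conj)).2
    ⟨h.Q_map_eq_zero_iff.2 h1, Δ u, h.isTripotent_iff.2 hu, (h.isTruncation_iff hu).2 heu,
      (h.isTruncation_iff hu).2 hvu⟩

theorem exists_map_conj (h : PreservesTruncations S T Δ) {e : X} (he : S.IsRankOne e) :
    ∃ r : ℂ, r ≠ 0 ∧ Δ (S.conj e) = r • T.conj (Δ e) := by
  obtain ⟨r, hr⟩ := Submodule.mem_span_singleton.1 (h.map_conj_mem_span he)
  refine ⟨r, ?_, hr.symm⟩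
  rintro rfl
  rw [zero_smul] at hr
  exact he.conj.ne_zero (h.map_eq_zero_iff.1 hr.symm)

theorem inner_conj_map_eq_zero_iff (h : PreservesTruncations S T Δ) {e : X} (he : S.IsRankOne e)
    (x : X) : inner ℂ (T.conj (Δ e)) (Δ x) = (0 : ℂ) ↔ inner ℂ (S.conj e) x = (0 : ℂ) := by
  obtain ⟨r, hr, hre⟩ := h.exists_map_conj he
  rw [← h.inner_map_eq_zero_iff he.conj, hre, inner_smul_left, mul_eq_zero]
  simp [hr]

theorem map_mem_span_conj_iff (h : PreservesTruncations S T Δ) {e : X} (he : S.IsRankOne e)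
    {x : X} : Δ x ∈ Submodule.span ℂ {T.conj (Δ e)} ↔ x ∈ Submodule.span ℂ {S.conj e} := by
  obtain ⟨r, hr, hre⟩ := h.exists_map_conj he
  rw [← h.map_mem_span_iff he.conj, hre, Submodule.span_singleton_smul_eq (IsUnit.mk0 r hr)]

/-- Orthogonality of a rank-one tripotent to `Q(b)(c)` is preserved for all `b` and `c`. It is this
fact that gives access to elements of rank two. -/
theorem inner_map_Q_eq_zero_iff (h : PreservesTruncations S T Δ) {e : X} (he : S.IsRankOne e)
    (b c : X) : inner ℂ (Δ e) (T.Q (Δ b) (Δ c)) = (0 : ℂ) ↔ inner ℂ e (S.Q b c) = (0 : ℂ) := by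
  rw [← not_iff_not, ← ne_eq, ← ne_eq, he.inner_ne_zero_iff, (h.isRankOne_map he).inner_ne_zero_iff,
    ← Δ.exists_congr_right]
  simp only [h.map_mem_span_iff he, ne_eq, h.map_eq_zero_iff, ← h _ b c]

theorem map_mem_span_isRankTwo_iff (h : PreservesTruncations S T Δ) (hX : 4 ≤ Module.rank ℂ X)
    (hY : 4 ≤ Module.rank ℂ Y) {g : X} (hg : S.IsRankTwo g) (x : X) :
    Δ x ∈ Submodule.span ℂ {Δ g} ↔ x ∈ Submodule.span ℂ {g} := by
  rw [hg.mem_span_iff hX, (h.isRankTwo_map hg).mem_span_iff hY, ← Δ.forall_congr_right,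
    h.map_eq_zero_iff]
  refine or_congr_right (forall_congr' fun a => ?_)
  rw [h.isRankOne_map_iff]
  refine imp_congr_right fun ha => ?_
  rw [h.inner_map_eq_zero_iff ha, h.inner_map_eq_zero_iff ha]

/-- Orthogonality to rank-two tripotents is preserved. -/
theorem inner_map_isRankTwo_eq_zero_iff (h : PreservesTruncations S T Δ)
    (hX : 4 ≤ Module.rank ℂ X) (hY : 4 ≤ Module.rank ℂ Y) {g : X} (hg : S.IsRankTwo g) (x : X) :
    inner ℂ (Δ g) (Δ x) = (0 : ℂ) ↔ inner ℂ g x = (0 : ℂ) := by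
  have key : (inner ℂ (Δ g) (Δ x) = (0 : ℂ) ∨ Δ x ∈ Submodule.span ℂ {Δ g}) ↔
      (inner ℂ g x = (0 : ℂ) ∨ x ∈ Submodule.span ℂ {g}) := by
    rw [hg.inner_eq_zero_or_mem_span_iff hX, (h.isRankTwo_map hg).inner_eq_zero_or_mem_span_iff hY,
      ← Δ.forall_congr_right]
    refine forall_congr' fun a => ?_
    rw [h.isRankOne_map_iff]
    refine imp_congr_right fun ha => ?_
    rw [h.inner_map_Q_eq_zero_iff ha, T.inner_conj_right, S.inner_conj_right,
      inner_eq_zero_symm (x := Δ x), inner_eq_zero_symm (x := x), h.inner_conj_map_eq_zero_iff ha]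
  have hspan := h.map_mem_span_isRankTwo_iff hX hY hg x
  have hg0 := hg.ne_zero
  have hg0' := (h.isRankTwo_map hg).ne_zero
  by_cases hx : x ∈ Submodule.span ℂ {g}
  · rw [inner_eq_zero_iff_of_mem_span hg0 hx, inner_eq_zero_iff_of_mem_span hg0' (hspan.2 hx),
      h.map_eq_zero_iff]
  · have hx' : Δ x ∉ Submodule.span ℂ {Δ g} := fun h1 => hx (hspan.1 h1)
    rwa [or_iff_left hx', or_iff_left hx] at key

end PreservesTruncations

/-! ### The triples of two by two matrices -/

/-- The operator norm of a complex 2 by 2 matrix in terms of its Hilbert-Schmidt norm and its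
determinant: its square is the larger root of `t² - (∑ |A i j|²) t + |det A|²`, the characteristic
polynomial of `A* A`. -/
theorem norm_toEuclideanCLM_fin_two (A : Matrix (Fin 2) (Fin 2) ℂ) :
    ‖Matrix.toEuclideanCLM (n := Fin 2) (𝕜 := ℂ) A‖ =
      Real.sqrt ((∑ i, ∑ j, ‖A i j‖ ^ 2) / 2 +
        Real.sqrt (((∑ i, ∑ j, ‖A i j‖ ^ 2) / 2) ^ 2 - ‖A.det‖ ^ 2)) := by
  -- `p`, `r`, `q` are the entries of the Gram matrix `A* A`
  set p : ℝ := ‖A 0 0‖ ^ 2 + ‖A 1 0‖ ^ 2 with hp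
  set r : ℝ := ‖A 0 1‖ ^ 2 + ‖A 1 1‖ ^ 2 with hr
  set q : ℂ := starRingEnd ℂ (A 0 0) * A 0 1 + starRingEnd ℂ (A 1 0) * A 1 1 with hq
  have hT : (∑ i, ∑ j, ‖A i j‖ ^ 2) / 2 = (p + r) / 2 := by
    simp only [Fin.sum_univ_two, hp, hr]; ring
  have hdet : p * r - ‖q‖ ^ 2 = ‖A.det‖ ^ 2 := by
    rw [Matrix.det_fin_two]
    simp only [hp, hr, hq, ← Complex.normSq_eq_norm_sq, Complex.normSq_apply, Complex.add_re,
      Complex.add_im, Complex.sub_re, Complex.sub_im, Complex.mul_re, Complex.mul_im,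
      Complex.conj_re, Complex.conj_im]
    ring
  rw [hT, ← hdet]
  have hdisc : ((p + r) / 2) ^ 2 - (p * r - ‖q‖ ^ 2) = ((p - r) / 2) ^ 2 + ‖q‖ ^ 2 := by ring
  rw [hdisc]
  set s := Real.sqrt (((p - r) / 2) ^ 2 + ‖q‖ ^ 2) with hs
  have hss : s ^ 2 = ((p - r) / 2) ^ 2 + ‖q‖ ^ 2 := Real.sq_sqrt (by positivity)
  have hs0 : |(p - r) / 2| ≤ s := Real.abs_le_sqrt (by nlinarith [sq_nonneg ‖q‖])
  have hs1 := abs_le.1 hs0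
  set l := (p + r) / 2 + s with hl
  have hlp : 0 ≤ l - p := by linarith [hs1.1]
  have hlr : 0 ≤ l - r := by linarith [hs1.2]
  have hl0 : 0 ≤ l := by
    have : 0 ≤ p := by positivity
    linarith
  have hprod : (l - p) * (l - r) = ‖q‖ ^ 2 := by rw [hl]; linear_combination hss
  have hnorm : ∀ v : EuclideanSpace ℂ (Fin 2),
      ‖Matrix.toEuclideanCLM (n := Fin 2) (𝕜 := ℂ) A v‖ ^ 2 = p * ‖v 0‖ ^ 2 + r * ‖v 1‖ ^ 2 +
        2 * (starRingEnd ℂ (v 0) * v 1 * q).re := by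
    intro v
    rw [EuclideanSpace.norm_sq_eq]
    simp only [Fin.sum_univ_two, Matrix.ofLp_toEuclideanCLM, Matrix.mulVec, dotProduct]
    simp only [hp, hr, hq, ← Complex.normSq_eq_norm_sq, Complex.normSq_apply, Complex.add_re,
      Complex.add_im, Complex.mul_re, Complex.mul_im, Complex.conj_re, Complex.conj_im]
    ring
  have hv2 : ∀ v : EuclideanSpace ℂ (Fin 2), ‖v‖ ^ 2 = ‖v 0‖ ^ 2 + ‖v 1‖ ^ 2 := by
    intro v
    rw [EuclideanSpace.norm_sq_eq, Fin.sum_univ_two]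
  refine ContinuousLinearMap.opNorm_eq_of_bounds (Real.sqrt_nonneg _) (fun v => ?_)
    (fun N hN hb => ?_)
  · refine (sq_le_sq₀ (norm_nonneg _) (by positivity)).1 ?_
    rw [mul_pow, Real.sq_sqrt hl0, hnorm, hv2]
    have h1 : (starRingEnd ℂ (v 0) * v 1 * q).re ≤ ‖v 0‖ * ‖v 1‖ * ‖q‖ := by
      refine (Complex.re_le_norm _).trans (le_of_eq ?_)
      rw [norm_mul, norm_mul, RCLike.norm_conj]
    have h2 : ‖q‖ = Real.sqrt (l - p) * Real.sqrt (l - r) := by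
      rw [← Real.sqrt_mul hlp, hprod, Real.sqrt_sq (norm_nonneg _)]
    rw [h2] at h1
    nlinarith [sq_nonneg (Real.sqrt (l - p) * ‖v 0‖ - Real.sqrt (l - r) * ‖v 1‖),
      Real.sq_sqrt hlp, Real.sq_sqrt hlr]
  · -- an eigenvector of `A* A` for the eigenvalue `l`
    obtain ⟨v, hv0, hv⟩ : ∃ v : EuclideanSpace ℂ (Fin 2), v ≠ 0 ∧
        ‖Matrix.toEuclideanCLM (n := Fin 2) (𝕜 := ℂ) A v‖ ^ 2 = l * ‖v‖ ^ 2 := by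
      by_cases hl1 : l - p = 0
      · have hq0 : q = 0 := by
          rw [hl1, zero_mul] at hprod
          simpa using hprod.symm
        refine ⟨!₂[1, 0], fun h => ?_, ?_⟩
        · have := congrArg (fun w : EuclideanSpace ℂ (Fin 2) => w 0) h
          simp at this
        · rw [hnorm, hv2]
          simp
          linarith
      · refine ⟨!₂[q, ((l - p : ℝ) : ℂ)], fun h => ?_, ?_⟩
        · have := congrArg (fun w : EuclideanSpace ℂ (Fin 2) => w 1) h
          simp only [Matrix.cons_val_one, Matrix.cons_val_zero, PiLp.zero_apply] at this
          exact hl1 (by exact_mod_cast this)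
        · have h1 : (starRingEnd ℂ q * ((l - p : ℝ) : ℂ) * q).re = (l - p) * ‖q‖ ^ 2 := by
            rw [mul_right_comm, Complex.conj_mul', ← Complex.ofReal_pow, ← Complex.ofReal_mul,
              Complex.ofReal_re, mul_comm]
          have h2 : ‖((l - p : ℝ) : ℂ)‖ ^ 2 = (l - p) ^ 2 := by
            rw [Complex.norm_real, Real.norm_eq_abs, sq_abs]
          rw [hnorm, hv2]
          simp only [Matrix.cons_val_zero, Matrix.cons_val_one, h1, h2]
          linear_combination -(l - p) * hprod
    refine Real.sqrt_le_iff.2 ⟨hN, ?_⟩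
    have h1 := pow_le_pow_left₀ (norm_nonneg _) (hb v) 2
    rw [hv, mul_pow] at h1
    exact le_of_mul_le_mul_right h1 (by positivity)

namespace SpinFactor

variable {X : Type*} [NormedAddCommGroup X] [InnerProductSpace ℂ X] [CompleteSpace X]

theorem RealOrthonormal.inner_sum {S : SpinFactor X} {n : ℕ} {v : Fin n → X}
    (hv : S.RealOrthonormal v) (x y : Fin n → ℂ) :
    inner ℂ (∑ i, x i • v i) (∑ i, y i • v i) = ∑ i, starRingEnd ℂ (x i) * y i :=
  hv.2.inner_sum x y Finset.univ

theorem RealOrthonormal.conj_sum {S : SpinFactor X} {n : ℕ} {v : Fin n → X}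
    (hv : S.RealOrthonormal v) (x : Fin n → ℂ) :
    S.conj (∑ i, x i • v i) = ∑ i, starRingEnd ℂ (x i) • v i := by
  rw [map_sum]
  exact Finset.sum_congr rfl fun i _ => by rw [S.conj_smul, hv.1]

/-- The triple product in the coordinates of a real orthonormal system. -/
theorem RealOrthonormal.tp_sum {S : SpinFactor X} {n : ℕ} {v : Fin n → X}
    (hv : S.RealOrthonormal v) (x y z : Fin n → ℂ) :
    S.tp (∑ i, x i • v i) (∑ i, y i • v i) (∑ i, z i • v i) =
      ∑ i, ((∑ j, starRingEnd ℂ (y j) * x j) * z i + (∑ j, starRingEnd ℂ (y j) * z j) * x i -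
        (∑ j, z j * x j) * starRingEnd ℂ (y i)) • v i := by
  rw [tp, hv.inner_sum, hv.inner_sum, hv.conj_sum, hv.conj_sum, hv.inner_sum]
  simp only [Complex.conj_conj, Finset.smul_sum, smul_smul, ← Finset.sum_add_distrib,
    ← Finset.sum_sub_distrib, ← add_smul, ← sub_smul]

theorem RealOrthonormal.isSubtriple_span {S : SpinFactor X} {n : ℕ} {v : Fin n → X}
    (hv : S.RealOrthonormal v) : S.IsSubtriple (Submodule.span ℂ (Set.range v)) := by
  have hfd : FiniteDimensional ℂ (Submodule.span ℂ (Set.range v)) :=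
    FiniteDimensional.span_of_finite ℂ (Set.finite_range v)
  refine ⟨Submodule.closed_of_finiteDimensional _, fun x hx y hy z hz => ?_⟩
  obtain ⟨x, rfl⟩ := (Submodule.mem_span_range_iff_exists_fun ℂ).1 hx
  obtain ⟨y, rfl⟩ := (Submodule.mem_span_range_iff_exists_fun ℂ).1 hy
  obtain ⟨z, rfl⟩ := (Submodule.mem_span_range_iff_exists_fun ℂ).1 hz
  rw [hv.tp_sum]
  exact (Submodule.mem_span_range_iff_exists_fun ℂ).2 ⟨_, rfl⟩

theorem RealOrthonormal.generated_eq {S : SpinFactor X} {n : ℕ} {v : Fin n → X}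
    (hv : S.RealOrthonormal v) : S.generated (Set.range v) = Submodule.span ℂ (Set.range v) :=
  le_antisymm (sInf_le ⟨hv.isSubtriple_span, Submodule.subset_span⟩)
    (le_sInf fun _ hM => Submodule.span_le.2 hM.2)

/-- A space of matrices with linear coordinates in which the triple product is that of a spin
factor, the Hilbert norm is half of the Hilbert-Schmidt norm, and the bilinear form is the
determinant, is isomorphic to the span of a real orthonormal system. -/
theorem RealOrthonormal.isIsomorphicTo {S : SpinFactor X} {n : ℕ} {v : Fin n → X}
    (hv : S.RealOrthonormal v) {V : Submodule ℂ (Matrix (Fin 2) (Fin 2) ℂ)}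
    (f : V ≃ₗ[ℂ] (Fin n → ℂ))
    (htp : ∀ A B C D : V, (D : Matrix (Fin 2) (Fin 2) ℂ) = matrixTp A B C → ∀ i,
      f D i = (∑ j, starRingEnd ℂ (f B j) * f A j) * f C i +
        (∑ j, starRingEnd ℂ (f B j) * f C j) * f A i -
        (∑ j, f C j * f A j) * starRingEnd ℂ (f B i))
    (hnorm : ∀ A : V, ∑ j, ‖f A j‖ ^ 2 = (∑ i, ∑ j, ‖(A : Matrix (Fin 2) (Fin 2) ℂ) i j‖ ^ 2) / 2)
    (hdet : ∀ A : V, ∑ j, f A j * f A j = (A : Matrix (Fin 2) (Fin 2) ℂ).det) :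
    S.IsIsomorphicTo (Submodule.span ℂ (Set.range v)) V := by
  set b := Module.Basis.span hv.2.linearIndependent with hb
  have hφ : ∀ A : V, ((f.trans b.equivFun.symm A : Submodule.span ℂ (Set.range v)) : X) =
      ∑ i, f A i • v i := by
    intro A
    rw [LinearEquiv.trans_apply, Module.Basis.equivFun_symm_apply, Submodule.coe_sum]
    exact Finset.sum_congr rfl fun i _ => by
      rw [Submodule.coe_smul, hb, Module.Basis.span_apply]
  refine ⟨hv.isSubtriple_span, f.trans b.equivFun.symm, fun A B C D hD => ?_, fun A => ?_⟩
  · rw [hφ, hφ, hφ, hφ, hv.tp_sum]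
    exact Finset.sum_congr rfl fun i _ => by rw [htp A B C D hD i]
  · have h1 : ‖∑ i, f A i • v i‖ ^ 2 =
        (∑ i, ∑ j, ‖(A : Matrix (Fin 2) (Fin 2) ℂ) i j‖ ^ 2) / 2 := by
      rw [← hnorm A]
      have h2 := hv.inner_sum (f A) (f A)
      rw [inner_self_eq_norm_sq_to_K] at h2
      simp only [Complex.conj_mul', Complex.coe_algebraMap] at h2
      exact_mod_cast h2
    rw [hφ, norm_toEuclideanCLM_fin_two, spinNorm, hv.conj_sum, hv.inner_sum, h1]
    simp only [Complex.conj_conj]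
    rw [hdet]

/-- Coordinates on `M_2` that turn the determinant into a sum of four squares. -/
noncomputable def matrixM2Equiv : matrixM2 ≃ₗ[ℂ] (Fin 4 → ℂ) where
  toFun A := ![(A.1 0 0 + A.1 1 1) / 2, Complex.I * (A.1 0 0 - A.1 1 1) / 2,
    (A.1 0 1 - A.1 1 0) / 2, Complex.I * (A.1 0 1 + A.1 1 0) / 2]
  map_add' A B := by
    ext i
    fin_cases i <;> simp <;> ring
  map_smul' r A := by
    ext i
    fin_cases i <;> simp <;> ring
  invFun x := ⟨!![x 0 - Complex.I * x 1, x 2 - Complex.I * x 3;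
    -x 2 - Complex.I * x 3, x 0 + Complex.I * x 1], Submodule.mem_top⟩
  left_inv A := by
    ext i j
    fin_cases i <;> fin_cases j <;> simp <;> ring_nf <;> simp <;> ring
  right_inv x := by
    ext i
    fin_cases i <;> simp <;> ring_nf <;> simp

/-- Coordinates on `S_2` that turn the determinant into a sum of three squares. -/
noncomputable def matrixS2Equiv : matrixS2 ≃ₗ[ℂ] (Fin 3 → ℂ) where
  toFun A := ![(A.1 0 0 + A.1 1 1) / 2, Complex.I * (A.1 0 0 - A.1 1 1) / 2,
    Complex.I * A.1 0 1]
  map_add' A B := by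
    ext i
    fin_cases i <;> simp <;> ring
  map_smul' r A := by
    ext i
    fin_cases i <;> simp <;> ring
  invFun x := ⟨!![x 0 - Complex.I * x 1, -Complex.I * x 2; -Complex.I * x 2,
    x 0 + Complex.I * x 1], by
      change Matrix.transpose _ = _
      ext i j
      fin_cases i <;> fin_cases j <;> simp⟩
  left_inv A := by
    have h : A.1 1 0 = A.1 0 1 := congrFun (congrFun A.2 0) 1
    ext i j
    fin_cases i <;> fin_cases j <;> simp [h] <;> ring_nf <;> simp <;> ring
  right_inv x := by
    ext i
    fin_cases i <;> simp <;> ring_nf <;> simp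

theorem RealOrthonormal.isIsomorphicTo_matrixM2 {S : SpinFactor X} {v : Fin 4 → X}
    (hv : S.RealOrthonormal v) : S.IsIsomorphicTo (Submodule.span ℂ (Set.range v)) matrixM2 := by
  refine hv.isIsomorphicTo matrixM2Equiv ?_ ?_ ?_
  · intro A B C D hD i
    fin_cases i <;>
    · simp [matrixM2Equiv, hD, matrixTp, Matrix.mul_apply, Fin.sum_univ_two, Fin.sum_univ_four]
      ring_nf
      simp only [Complex.I_sq, Complex.I_pow_three, Complex.conj_ofNat]
      ring
  · intro A
    simp [matrixM2Equiv, Fin.sum_univ_two, Fin.sum_univ_four, ← Complex.normSq_eq_norm_sq,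
      Complex.normSq_apply]
    ring
  · intro A
    rw [Matrix.det_fin_two]
    simp [matrixM2Equiv, Fin.sum_univ_four]
    ring_nf
    simp
    ring

theorem RealOrthonormal.isIsomorphicTo_matrixS2 {S : SpinFactor X} {v : Fin 3 → X}
    (hv : S.RealOrthonormal v) : S.IsIsomorphicTo (Submodule.span ℂ (Set.range v)) matrixS2 := by
  refine hv.isIsomorphicTo matrixS2Equiv ?_ ?_ ?_
  · intro A B C D hD i
    have hA : A.1 1 0 = A.1 0 1 := congrFun (congrFun A.2 0) 1
    have hB : B.1 1 0 = B.1 0 1 := congrFun (congrFun B.2 0) 1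
    have hC : C.1 1 0 = C.1 0 1 := congrFun (congrFun C.2 0) 1
    fin_cases i <;>
    · simp [matrixS2Equiv, hD, matrixTp, Matrix.mul_apply, Fin.sum_univ_two, Fin.sum_univ_three, hA, hB, hC]
      ring_nf
      simp only [Complex.I_sq, Complex.I_pow_three, Complex.conj_ofNat]
      ring
  · intro A
    have h : A.1 1 0 = A.1 0 1 := congrFun (congrFun A.2 0) 1
    simp [matrixS2Equiv, Fin.sum_univ_two, Fin.sum_univ_three, ← Complex.normSq_eq_norm_sq,
      Complex.normSq_apply, h]
    ring
  · intro A
    have h : A.1 1 0 = A.1 0 1 := congrFun (congrFun A.2 0) 1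
    rw [Matrix.det_fin_two]
    simp [matrixS2Equiv, Fin.sum_univ_three, h]
    ring_nf
    simp
    ring

end SpinFactor

/-! ### Spans of real orthonormal systems -/

namespace SpinFactor

variable {X : Type*} [NormedAddCommGroup X] [InnerProductSpace ℂ X] [CompleteSpace X]

theorem isRankTwo_of_real {S : SpinFactor X} {g : X} (hg : S.conj g = g)
    (hgg : inner ℂ g g = (1 : ℂ)) : S.IsRankTwo g :=
  ⟨hgg, 1, by rw [hg, one_smul]⟩

/-- The span of a real orthonormal system is the intersection of the hyperplanes orthogonal to the
real unit vectors that are orthogonal to the system. -/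
theorem RealOrthonormal.mem_span_iff {S : SpinFactor X} {n : ℕ} {v : Fin n → X}
    (hv : S.RealOrthonormal v) (x : X) : x ∈ Submodule.span ℂ (Set.range v) ↔
      ∀ g, S.conj g = g → inner ℂ g g = (1 : ℂ) → (∀ i, inner ℂ (v i) g = (0 : ℂ)) →
        inner ℂ g x = (0 : ℂ) := by
  have hfd : FiniteDimensional ℂ (Submodule.span ℂ (Set.range v)) :=
    FiniteDimensional.span_of_finite ℂ (Set.finite_range v)
  constructor
  · intro hx g _ _ hvg
    obtain ⟨t, rfl⟩ := (Submodule.mem_span_range_iff_exists_fun ℂ).1 hx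
    rw [_root_.inner_sum]
    exact Finset.sum_eq_zero fun i _ => by
      rw [inner_smul_right, inner_eq_zero_symm.1 (hvg i), mul_zero]
  · intro h
    -- the unit length of `g` is irrelevant
    have hreal : ∀ g, S.conj g = g → (∀ i, inner ℂ (v i) g = (0 : ℂ)) →
        inner ℂ g x = (0 : ℂ) := by
      intro g hg hvg
      by_cases hg0 : g = 0
      · rw [hg0, inner_zero_left]
      · obtain ⟨d, hd, hdd, hds⟩ := S.exists_real_mem_span hg0
        rw [hg, Set.pair_eq_singleton] at hds
        obtain ⟨t, rfl⟩ := Submodule.mem_span_singleton.1 hds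
        have ht : t ≠ 0 := by
          rintro rfl
          norm_num at hdd
        have h1 := h _ hd hdd fun i => by rw [inner_smul_right, hvg i, mul_zero]
        rw [inner_smul_left] at h1
        simpa [ht] using h1
    rw [← Submodule.orthogonal_orthogonal (Submodule.span ℂ (Set.range v)),
      Submodule.mem_orthogonal]
    intro y hy
    have hvy : ∀ i, inner ℂ (v i) y = (0 : ℂ) := fun i =>
      (Submodule.mem_orthogonal _ _).1 hy _ (Submodule.subset_span ⟨i, rfl⟩)
    have hvy' : ∀ i, inner ℂ (v i) (S.conj y) = (0 : ℂ) := fun i => by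
      rw [S.inner_conj_right, hv.1, inner_eq_zero_symm.1 (hvy i)]
    have h1 := hreal (y + S.conj y) (by rw [map_add, S.conj_conj, add_comm]) fun i => by
      rw [inner_add_right, hvy, hvy', add_zero]
    have h2 := hreal (Complex.I • (y - S.conj y))
      (by rw [S.conj_smul, map_sub, S.conj_conj, Complex.conj_I]; module) fun i => by
      rw [inner_smul_right, inner_sub_right, hvy, hvy', sub_zero, mul_zero]
    rw [inner_add_left] at h1
    rw [inner_smul_left, inner_sub_left, Complex.conj_I] at h2
    linear_combination h1 / 2 + Complex.I * h2 / 2 +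
      Complex.I_mul_I * (inner ℂ y x - inner ℂ (S.conj y) x) / 2

/-- A subspace that contains an orthonormal system with trivial orthogonal complement in it is the
span of the system. -/
theorem RealOrthonormal.eq_span {S : SpinFactor X} {n : ℕ} {v : Fin n → X}
    (hv : S.RealOrthonormal v) {N : Submodule ℂ X} (hvN : ∀ i, v i ∈ N)
    (h : ∀ y ∈ N, (∀ i, inner ℂ (v i) y = (0 : ℂ)) → y = 0) :
    N = Submodule.span ℂ (Set.range v) := by
  refine le_antisymm (fun y hy => ?_) (Submodule.span_le.2 (Set.range_subset_iff.2 hvN))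
  refine (Submodule.mem_span_range_iff_exists_fun ℂ).2 ⟨fun i => inner ℂ (v i) y, ?_⟩
  refine (sub_eq_zero.1 (h _ (Submodule.sub_mem _ hy (Submodule.sum_mem _ fun i _ =>
    Submodule.smul_mem _ _ (hvN i))) fun i => ?_)).symm
  rw [inner_sub_right, hv.2.inner_right_fintype, sub_self]

theorem exists_realOrthonormal (S : SpinFactor X) (n : ℕ) (hn : (n : Cardinal) ≤ Module.rank ℂ X) :
    ∃ v : Fin n → X, S.RealOrthonormal v := by
  induction n with
  | zero => exact ⟨Fin.elim0, fun i => i.elim0, orthonormal_iff_ite.2 fun i => i.elim0⟩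
  | succ n ih =>
    have hlt : (n : Cardinal) < Module.rank ℂ X :=
      lt_of_lt_of_le (by exact_mod_cast n.lt_succ_self) hn
    obtain ⟨v, hv⟩ := ih hlt.le
    obtain ⟨d, hd, hdd, hvd⟩ := S.exists_real_orthogonal v (fun i => ⟨i, hv.1 i⟩) hlt
    exact ⟨_, realOrthonormal_cons_iff.2 ⟨hd, hdd, hvd, hv⟩⟩

theorem realOrthonormal_of_halfPlus {S : SpinFactor X} {a b c d : X}
    (hab : S.RealOrthonormal ![a, b]) (hcd : S.RealOrthonormal ![c, d])
    (h : halfPlus c d ∈ hilbertPerp {a, b}) : S.RealOrthonormal ![a, b, c, d] := by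
  obtain ⟨ha, hb, -⟩ := realOrthonormal_pair_iff.1 hab
  obtain ⟨hc, hd, hcc, hdd, hcd', -⟩ := realOrthonormal_pair_iff.1 hcd
  have h' : halfMinus c d ∈ hilbertPerp {a, b} := by
    rw [mem_hilbertPerp_pair] at h ⊢
    rw [← S.conj_halfPlus hc hd, S.inner_conj_right a, S.inner_conj_right b, ha, hb,
      inner_eq_zero_symm.1 h.1, inner_eq_zero_symm.1 h.2]
    simp
  have h1 := Submodule.add_mem _ h h'
  have h2 := Submodule.smul_mem _ Complex.I (Submodule.sub_mem _ h' h)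
  rw [halfPlus_add_halfMinus, mem_hilbertPerp_pair] at h1
  rw [I_smul_halfMinus_sub_halfPlus, mem_hilbertPerp_pair] at h2
  exact realOrthonormal_quadruple_iff.2 ⟨realOrthonormal_triple_iff.2
    ⟨hab, hc, hcc, h1⟩, hd, hdd, h2.1, h2.2, hcd'⟩

theorem halfPlus_mem {E : Type*} [AddCommGroup E] [Module ℂ E] {N : Submodule ℂ E} {a b : E}
    (ha : a ∈ N) (hb : b ∈ N) : halfPlus a b ∈ N :=
  N.smul_mem _ (N.add_mem ha (N.smul_mem _ hb))

theorem mem_of_halfPlus_mem {S : SpinFactor X} {a b : X} (h : S.RealOrthonormal ![a, b])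
    {N : Submodule ℂ X} (hN : ∀ y ∈ N, S.conj y ∈ N) (he : halfPlus a b ∈ N) : a ∈ N ∧ b ∈ N := by
  obtain ⟨ha, hb, -⟩ := realOrthonormal_pair_iff.1 h
  have he' := hN _ he
  rw [S.conj_halfPlus ha hb] at he'
  constructor
  · rw [← halfPlus_add_halfMinus a b]
    exact N.add_mem he he'
  · rw [← I_smul_halfMinus_sub_halfPlus a b]
    exact N.smul_mem _ (N.sub_mem he' he)

theorem range_pair {α : Type*} (a b : α) : Set.range ![a, b] = {a, b} := by
  ext x
  simp
  tauto

theorem range_triple {α : Type*} (a b c : α) : Set.range ![a, b, c] = {a, b, c} := by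
  ext x
  simp
  tauto

theorem range_quadruple {α : Type*} (a b c d : α) : Set.range ![a, b, c, d] = {a, b, c, d} := by
  ext x
  simp
  tauto

/-- A step of the Gram-Schmidt process inside the real vectors. -/
theorem RealOrthonormal.mem_span_or_exists {S : SpinFactor X} {n : ℕ} {v : Fin n → X}
    (hv : S.RealOrthonormal v) {p : X} (hp : S.conj p = p) :
    p ∈ Submodule.span ℂ (Set.range v) ∨ ∃ d, S.conj d = d ∧ inner ℂ d d = (1 : ℂ) ∧
      (∀ i, inner ℂ (v i) d = (0 : ℂ)) ∧ p ∈ Submodule.span ℂ (insert d (Set.range v)) := by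
  set y := p - ∑ i, inner ℂ (v i) p • v i with hy
  have hsum : ∑ i, inner ℂ (v i) p • v i ∈ Submodule.span ℂ (Set.range v) :=
    (Submodule.mem_span_range_iff_exists_fun ℂ).2 ⟨_, rfl⟩
  by_cases hy0 : y = 0
  · left
    rw [sub_eq_zero.1 hy0]
    exact hsum
  · right
    have hvy : ∀ i, inner ℂ (v i) y = (0 : ℂ) := fun i => by
      rw [hy, inner_sub_right, hv.2.inner_right_fintype, sub_self]
    have hcy : S.conj y = y := by
      rw [hy, map_sub, hp, hv.conj_sum]
      congr 1
      refine Finset.sum_congr rfl fun i _ => ?_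
      rw [inner_conj_symm, ← S.inner_conj_conj, hv.1, hp]
    obtain ⟨d, hd, hdd, hds⟩ := S.exists_real_mem_span hy0
    rw [hcy, Set.pair_eq_singleton] at hds
    obtain ⟨t, rfl⟩ := Submodule.mem_span_singleton.1 hds
    have ht : t ≠ 0 := by
      rintro rfl
      norm_num at hdd
    refine ⟨_, hd, hdd, fun i => by rw [inner_smul_right, hvy i, mul_zero], ?_⟩
    have : p = t⁻¹ • t • y + ∑ i, inner ℂ (v i) p • v i := by
      rw [smul_smul, inv_mul_cancel₀ ht, one_smul, hy, sub_add_cancel]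
    rw [this]
    exact Submodule.add_mem _ (Submodule.smul_mem _ _ (Submodule.subset_span (Set.mem_insert _ _)))
      (Submodule.span_mono (Set.subset_insert _ _) hsum)

/-- Two rank-one tripotents lie in the span of three or four real orthonormal vectors. -/
theorem IsRankOne.exists_mem_span {S : SpinFactor X} {e v : X} (he : S.IsRankOne e)
    (hv : S.IsRankOne v) :
    (∃ a b c, S.RealOrthonormal ![a, b, c] ∧ e ∈ Submodule.span ℂ (Set.range ![a, b, c]) ∧
      v ∈ Submodule.span ℂ (Set.range ![a, b, c])) ∨
    ∃ a b c d, S.RealOrthonormal ![a, b, c, d] ∧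
      e ∈ Submodule.span ℂ (Set.range ![a, b, c, d]) ∧
      v ∈ Submodule.span ℂ (Set.range ![a, b, c, d]) := by
  obtain ⟨a, b, hab, rfl⟩ := he.exists_halfPlus
  obtain ⟨p, q, hpq, rfl⟩ := hv.exists_halfPlus
  obtain ⟨hp, hq, -⟩ := realOrthonormal_pair_iff.1 hpq
  obtain ⟨ha, hb, -⟩ := realOrthonormal_pair_iff.1 hab
  obtain ⟨c, hc, hcc, hvc, hpc⟩ : ∃ c, S.conj c = c ∧ inner ℂ c c = (1 : ℂ) ∧
      (∀ i, inner ℂ (![a, b] i) c = (0 : ℂ)) ∧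
      p ∈ Submodule.span ℂ (insert c (Set.range ![a, b])) := by
    rcases hab.mem_span_or_exists hp with h | h
    · obtain ⟨c, hc, hcc, hvc⟩ := S.exists_real_orthogonal ![a, b] (fun i => ⟨i, hab.1 i⟩)
        (lt_of_lt_of_le (by norm_num) S.three_le_rank)
      exact ⟨c, hc, hcc, hvc, Submodule.span_mono (Set.subset_insert _ _) h⟩
    · exact h
  have habc : S.RealOrthonormal ![a, b, c] :=
    realOrthonormal_triple_iff.2 ⟨hab, hc, hcc, hvc 0, hvc 1⟩
  have hp3 : p ∈ Submodule.span ℂ ({a, b, c} : Set X) := by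
    rw [range_pair] at hpc
    refine Submodule.span_mono ?_ hpc
    intro x hx
    simp only [Set.mem_insert_iff, Set.mem_singleton_iff] at hx ⊢
    tauto
  rcases habc.mem_span_or_exists hq with h | ⟨d, hd, hdd, hvd, hqd⟩
  · left
    rw [range_triple] at h
    refine ⟨a, b, c, habc, ?_, ?_⟩ <;> rw [range_triple]
    · exact halfPlus_mem (Submodule.subset_span (by simp)) (Submodule.subset_span (by simp))
    · exact halfPlus_mem hp3 h
  · right
    refine ⟨a, b, c, d, realOrthonormal_quadruple_iff.2 ⟨habc, hd, hdd, hvd 0, hvd 1, hvd 2⟩,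
      ?_, ?_⟩ <;> rw [range_quadruple]
    · exact halfPlus_mem (Submodule.subset_span (by simp)) (Submodule.subset_span (by simp))
    · refine halfPlus_mem (Submodule.span_mono ?_ hp3) (Submodule.span_mono ?_ hqd)
      · intro x hx
        simp only [Set.mem_insert_iff, Set.mem_singleton_iff] at hx ⊢
        tauto
      · rw [range_triple]
        intro x hx
        simp only [Set.mem_insert_iff, Set.mem_singleton_iff] at hx ⊢
        tauto

end SpinFactor

/-! ### Images of spans of real orthonormal systems -/

namespace PreservesTruncations

open SpinFactor

variable {X Y : Type*} [NormedAddCommGroup X] [InnerProductSpace ℂ X] [CompleteSpace X]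
  [NormedAddCommGroup Y] [InnerProductSpace ℂ Y] [CompleteSpace Y]
  {S : SpinFactor X} {T : SpinFactor Y} {Δ : X ≃ Y}

theorem map_mem_hilbertPerp_iff (h : PreservesTruncations S T Δ) {a b : X} {a' b' : Y}
    (hab : S.RealOrthonormal ![a, b]) (hab' : T.RealOrthonormal ![a', b'])
    (he : Δ (halfPlus a b) = halfPlus a' b') (x : X) :
    Δ x ∈ hilbertPerp {a', b'} ↔ x ∈ hilbertPerp {a, b} := by
  obtain ⟨ha, hb, -⟩ := realOrthonormal_pair_iff.1 hab
  obtain ⟨ha', hb', -⟩ := realOrthonormal_pair_iff.1 hab'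
  have hr := isRankOne_halfPlus hab
  rw [← hilbertPerp_half a b, ← hilbertPerp_half a' b', mem_hilbertPerp_pair, mem_hilbertPerp_pair,
    ← T.conj_halfPlus ha' hb', ← S.conj_halfPlus ha hb, ← he, h.inner_map_eq_zero_iff hr,
    h.inner_conj_map_eq_zero_iff hr]

theorem exists_map_halfPlus (h : PreservesTruncations S T Δ) {a b : X}
    (hab : S.RealOrthonormal ![a, b]) :
    ∃ a' b', T.RealOrthonormal ![a', b'] ∧ Δ (halfPlus a b) = halfPlus a' b' :=
  (h.isRankOne_map (isRankOne_halfPlus hab)).exists_halfPlus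

theorem exists_map_quadruple (h : PreservesTruncations S T Δ) {a b c d : X}
    (hv : S.RealOrthonormal ![a, b, c, d]) :
    ∃ a' b' c' d', T.RealOrthonormal ![a', b', c', d'] ∧ T.RealOrthonormal ![a', b'] ∧
      T.RealOrthonormal ![c', d'] ∧
      Δ (halfPlus a b) = halfPlus a' b' ∧ Δ (halfPlus c d) = halfPlus c' d' := by
  have hv' := realOrthonormal_quadruple_iff.1 hv
  have hv'' := realOrthonormal_triple_iff.1 hv'.1
  have hab := hv''.1
  have hcd : S.RealOrthonormal ![c, d] := realOrthonormal_pair_iff.2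
    ⟨hv''.2.1, hv'.2.1, hv''.2.2.1, hv'.2.2.1, hv'.2.2.2.2.2, inner_eq_zero_symm.1 hv'.2.2.2.2.2⟩
  obtain ⟨a', b', hab', he⟩ := h.exists_map_halfPlus hab
  obtain ⟨c', d', hcd', hf⟩ := h.exists_map_halfPlus hcd
  refine ⟨a', b', c', d', realOrthonormal_of_halfPlus hab' hcd' ?_, hab', hcd', he, hf⟩
  rw [← hf, h.map_mem_hilbertPerp_iff hab hab' he]
  exact halfPlus_mem (mem_hilbertPerp_pair.2 hv''.2.2.2)
    (mem_hilbertPerp_pair.2 ⟨hv'.2.2.2.1, hv'.2.2.2.2.1⟩)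

/-- Dimension at least four is equivalent to the existence of a rank-one tripotent orthogonal to
another one and to its conjugate, which is preserved. -/
theorem four_le_rank (h : PreservesTruncations S T Δ) (hX : 4 ≤ Module.rank ℂ X) :
    4 ≤ Module.rank ℂ Y := by
  obtain ⟨v, hv⟩ := S.exists_realOrthonormal 4 (by exact_mod_cast hX)
  have hv4 : v = ![v 0, v 1, v 2, v 3] := by
    ext i
    fin_cases i <;> rfl
  rw [hv4] at hv
  obtain ⟨a', b', c', d', hv', -⟩ := h.exists_map_quadruple hv
  exact_mod_cast hv'.le_rank

/-- The image of the span of at least three real orthonormal vectors is a linear subspace that is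
invariant under the conjugation: both are intersections of hyperplanes orthogonal to rank-two
tripotents, and such hyperplanes are mapped to each other. -/
theorem exists_submodule (h : PreservesTruncations S T Δ) {n : ℕ} (hn : 3 ≤ n) {v : Fin n → X}
    (hv : S.RealOrthonormal v) : ∃ N : Submodule ℂ Y, (∀ y ∈ N, T.conj y ∈ N) ∧
      ∀ x, Δ x ∈ N ↔ x ∈ Submodule.span ℂ (Set.range v) := by
  let G : Set X := {g | S.conj g = g ∧ inner ℂ g g = (1 : ℂ) ∧ ∀ i, inner ℂ (v i) g = (0 : ℂ)}
  have hG2 : ∀ g ∈ G, S.IsRankTwo g := fun g hg => isRankTwo_of_real hg.1 hg.2.1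
  have hmem : ∀ y : Y, y ∈ (Submodule.span ℂ (Δ '' G))ᗮ ↔ ∀ g ∈ G, inner ℂ (Δ g) y = (0 : ℂ) := by
    intro y
    rw [Submodule.mem_orthogonal]
    constructor
    · exact fun hy g hg => hy _ (Submodule.subset_span ⟨g, hg, rfl⟩)
    · intro hy u hu
      induction hu using Submodule.span_induction with
      | mem u hu =>
        obtain ⟨g, hg, rfl⟩ := hu
        exact hy g hg
      | zero => exact inner_zero_left _
      | add u w _ _ hu hw => rw [inner_add_left, hu, hw, add_zero]
      | smul r u _ hu => rw [inner_smul_left, hu, mul_zero]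
  refine ⟨(Submodule.span ℂ (Δ '' G))ᗮ, fun y hy => ?_, fun x => ?_⟩
  · rw [hmem] at hy ⊢
    intro g hg
    obtain ⟨-, κ, hκ⟩ := h.isRankTwo_map (hG2 g hg)
    rw [T.inner_conj_right, hκ, inner_smul_right, inner_eq_zero_symm.1 (hy g hg), mul_zero]
  · rw [hmem, hv.mem_span_iff]
    have key : ∀ g ∈ G, (inner ℂ (Δ g) (Δ x) = (0 : ℂ) ↔ inner ℂ g x = (0 : ℂ)) := by
      intro g hg
      have hr := (realOrthonormal_cons_iff.2 ⟨hg.1, hg.2.1, hg.2.2, hv⟩).le_rank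
      have hX : 4 ≤ Module.rank ℂ X :=
        le_trans (by exact_mod_cast Nat.succ_le_succ hn) hr
      exact h.inner_map_isRankTwo_eq_zero_iff hX (h.four_le_rank hX) (hG2 g hg) x
    exact ⟨fun h1 g hg hgg hvg => (key g ⟨hg, hgg, hvg⟩).1 (h1 g ⟨hg, hgg, hvg⟩),
      fun h1 g hg => (key g hg).2 (h1 g hg.1 hg.2.1 hg.2.2)⟩

/-- The image of the span of three real orthonormal vectors is again such a span. -/
theorem exists_image_triple (h : PreservesTruncations S T Δ) {a b c : X}
    (hv : S.RealOrthonormal ![a, b, c]) : ∃ w : Fin 3 → Y, T.RealOrthonormal w ∧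
      Δ '' (Submodule.span ℂ (Set.range ![a, b, c]) : Set X) =
        (Submodule.span ℂ (Set.range w) : Set Y) := by
  obtain ⟨N, hN, hΔN⟩ := h.exists_submodule le_rfl hv
  obtain ⟨hab, hc, hcc, hac, hbc⟩ := realOrthonormal_triple_iff.1 hv
  have hmem : ∀ i, ![a, b, c] i ∈ Submodule.span ℂ (Set.range ![a, b, c]) :=
    fun i => Submodule.subset_span ⟨i, rfl⟩
  obtain ⟨a', b', hab', he⟩ := h.exists_map_halfPlus hab
  obtain ⟨ha'N, hb'N⟩ := mem_of_halfPlus_mem hab' hN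
    (by rw [← he, hΔN]; exact halfPlus_mem (hmem 0) (hmem 1))
  obtain ⟨γ, c', hγ, hc', hnc', hcγ⟩ :=
    (h.isRankTwo_map (isRankTwo_of_real hc hcc)).exists_real
  have hγ0 : γ ≠ 0 := by rintro rfl; simp at hγ
  have hcc' : inner ℂ c' c' = (1 : ℂ) := by rw [inner_self_eq_norm_sq_to_K, hnc']; simp
  have hc'γ : c' = γ⁻¹ • Δ c := by rw [hcγ, smul_smul, inv_mul_cancel₀ hγ0, one_smul]
  have hc'N : c' ∈ N := by
    rw [hc'γ]
    exact N.smul_mem _ ((hΔN c).2 (hmem 2))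
  have hperp : c' ∈ hilbertPerp {a', b'} := by
    rw [hc'γ]
    exact Submodule.smul_mem _ _
      ((h.map_mem_hilbertPerp_iff hab hab' he c).2 (mem_hilbertPerp_pair.2 ⟨hac, hbc⟩))
  have hw : T.RealOrthonormal ![a', b', c'] :=
    realOrthonormal_triple_iff.2 ⟨hab', hc', hcc', mem_hilbertPerp_pair.1 hperp⟩
  refine ⟨_, hw, ?_⟩
  rw [← hw.eq_span (N := N)]
  · ext y
    obtain ⟨x, rfl⟩ := Δ.surjective y
    rw [Δ.injective.mem_set_image]
    exact (hΔN x).symm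
  · intro i
    fin_cases i
    exacts [ha'N, hb'N, hc'N]
  · intro y hy hwy
    by_contra hy0
    -- a fourth dimension of `N` would yield a rank-one tripotent orthogonal to `a'` and `b'`, while
    -- `c` spans the orthogonal complement of `a` and `b` in the domain
    obtain ⟨d', hd', hdd', hds⟩ := T.exists_real_mem_span hy0
    obtain ⟨r, s, hrs⟩ := Submodule.mem_span_pair.1 hds
    have hd'N : d' ∈ N := by
      rw [← hrs]
      exact N.add_mem (N.smul_mem _ hy) (N.smul_mem _ (hN _ hy))
    have hwd : ∀ i, inner ℂ (![a', b', c'] i) d' = (0 : ℂ) := fun i => by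
      rw [← hrs, inner_add_right, inner_smul_right, inner_smul_right, T.inner_conj_right,
        hw.1, hwy, inner_eq_zero_symm.1 (hwy i)]
      simp
    have hcd' : T.RealOrthonormal ![c', d'] := realOrthonormal_pair_iff.2
      ⟨hc', hd', hcc', hdd', hwd 2, inner_eq_zero_symm.1 (hwd 2)⟩
    obtain ⟨f, hf⟩ := Δ.surjective (halfPlus c' d')
    have hfr : S.IsRankOne f := by
      rw [← h.isRankOne_map_iff, hf]
      exact isRankOne_halfPlus hcd'
    have hfM : f ∈ Submodule.span ℂ (Set.range ![a, b, c]) := by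
      rw [← hΔN, hf]
      exact halfPlus_mem hc'N hd'N
    have hfp : f ∈ hilbertPerp {a, b} := by
      rw [← h.map_mem_hilbertPerp_iff hab hab' he, hf]
      exact halfPlus_mem hperp (mem_hilbertPerp_pair.2 ⟨hwd 0, hwd 1⟩)
    obtain ⟨t, ht⟩ := (Submodule.mem_span_range_iff_exists_fun ℂ).1 hfM
    have h0 : t 0 = 0 := by
      rw [← hv.2.inner_right_fintype t 0, ht]
      exact (mem_hilbertPerp_pair.1 hfp).1
    have h1 : t 1 = 0 := by
      rw [← hv.2.inner_right_fintype t 1, ht]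
      exact (mem_hilbertPerp_pair.1 hfp).2
    have h2 := hfr.1
    rw [← ht, hv.conj_sum, hv.inner_sum, Fin.sum_univ_three, h0, h1] at h2
    have h3 : t 2 = 0 := by simpa using h2
    refine hfr.ne_zero ?_
    rw [← ht, Fin.sum_univ_three, h0, h1, h3]
    simp

/-- The image of the span of four real orthonormal vectors is again such a span. -/
theorem exists_image_quadruple (h : PreservesTruncations S T Δ) {a b c d : X}
    (hv : S.RealOrthonormal ![a, b, c, d]) : ∃ w : Fin 4 → Y, T.RealOrthonormal w ∧
      Δ '' (Submodule.span ℂ (Set.range ![a, b, c, d]) : Set X) =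
        (Submodule.span ℂ (Set.range w) : Set Y) := by
  obtain ⟨N, hN, hΔN⟩ := h.exists_submodule (by norm_num) hv
  have hv' := realOrthonormal_quadruple_iff.1 hv
  have hv'' := realOrthonormal_triple_iff.1 hv'.1
  have hab := hv''.1
  have hcd : S.RealOrthonormal ![c, d] := realOrthonormal_pair_iff.2
    ⟨hv''.2.1, hv'.2.1, hv''.2.2.1, hv'.2.2.1, hv'.2.2.2.2.2, inner_eq_zero_symm.1 hv'.2.2.2.2.2⟩
  have hmem : ∀ i, ![a, b, c, d] i ∈ Submodule.span ℂ (Set.range ![a, b, c, d]) :=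
    fun i => Submodule.subset_span ⟨i, rfl⟩
  obtain ⟨a', b', c', d', hw, hab', hcd', he, hf⟩ := h.exists_map_quadruple hv
  obtain ⟨ha'N, hb'N⟩ := mem_of_halfPlus_mem hab' hN
    (by rw [← he, hΔN]; exact halfPlus_mem (hmem 0) (hmem 1))
  obtain ⟨hc'N, hd'N⟩ := mem_of_halfPlus_mem hcd' hN
    (by rw [← hf, hΔN]; exact halfPlus_mem (hmem 2) (hmem 3))
  refine ⟨_, hw, ?_⟩
  rw [← hw.eq_span (N := N)]
  · ext y
    obtain ⟨x, rfl⟩ := Δ.surjective y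
    rw [Δ.injective.mem_set_image]
    exact (hΔN x).symm
  · intro i
    fin_cases i
    exacts [ha'N, hb'N, hc'N, hd'N]
  · intro y hy hwy
    obtain ⟨x, rfl⟩ := Δ.surjective y
    rw [h.map_eq_zero_iff]
    have h1 := mem_hilbertPerp_pair.1 ((h.map_mem_hilbertPerp_iff hab hab' he x).1
      (mem_hilbertPerp_pair.2 ⟨hwy 0, hwy 1⟩))
    have h2 := mem_hilbertPerp_pair.1 ((h.map_mem_hilbertPerp_iff hcd hcd' hf x).1
      (mem_hilbertPerp_pair.2 ⟨hwy 2, hwy 3⟩))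
    obtain ⟨t, rfl⟩ := (Submodule.mem_span_range_iff_exists_fun ℂ).1 ((hΔN x).1 hy)
    have h3 : ∀ i, inner ℂ (![a, b, c, d] i) (∑ i, t i • ![a, b, c, d] i) = (0 : ℂ) := by
      intro i
      fin_cases i
      exacts [h1.1, h1.2, h2.1, h2.2]
    refine Finset.sum_eq_zero fun i _ => ?_
    rw [← hv.2.inner_right_fintype t i, h3, zero_smul]

end PreservesTruncations

theorem propositionr {X Y : Type*}
    [NormedAddCommGroup X] [InnerProductSpace ℂ X] [CompleteSpace X]
    [NormedAddCommGroup Y] [InnerProductSpace ℂ Y] [CompleteSpace Y]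
    (S : SpinFactor X) (T : SpinFactor Y) (Δ : X → Y)
    (hbij : Function.Bijective Δ) (hΔ : PreservesTruncations S T Δ) :
    -- (a)
    (∀ (γ : ℂ) (x : X), ‖γ‖ = 1 → S.conj x = x → ‖x‖ = 1 →
      ∃ (γ' : ℂ) (y : Y), ‖γ'‖ = 1 ∧ T.conj y = y ∧ ‖y‖ = 1 ∧ Δ (γ • x) = γ' • y) ∧
    -- (b)
    (∀ a b : X, S.RealOrthonormal ![a, b] →
      (∃! p : Y × Y, T.RealOrthonormal ![p.1, p.2] ∧ Δ (halfPlus a b) = halfPlus p.1 p.2) ∧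
      Disjoint (S.peirce 1 (halfPlus a b)) (S.peirce 0 (halfPlus a b)) ∧
      Disjoint (hilbertPerp {a, b}) (Submodule.span ℂ {halfMinus a b}) ∧
      S.peirce 1 (halfPlus a b) ⊔ S.peirce 0 (halfPlus a b) =
        hilbertPerp {a, b} ⊔ Submodule.span ℂ {halfMinus a b} ∧
      ∀ a' b' : Y, T.RealOrthonormal ![a', b'] → Δ (halfPlus a b) = halfPlus a' b' →
        Disjoint (hilbertPerp {a', b'}) (Submodule.span ℂ {halfMinus a' b'}) ∧
        Δ '' (↑(hilbertPerp {a, b} ⊔ Submodule.span ℂ {halfMinus a b}) : Set X) =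
          (↑(hilbertPerp {a', b'} ⊔ Submodule.span ℂ {halfMinus a' b'}) : Set Y)) ∧
    -- (c)
    (∀ a b : X, S.RealOrthonormal ![a, b] →
      ∀ a' b' : Y, T.RealOrthonormal ![a', b'] → Δ (halfPlus a b) = halfPlus a' b' →
        S.peirce 1 (halfPlus a b) = hilbertPerp {a, b} ∧
        Δ '' (S.peirce 1 (halfPlus a b) : Set X) = (T.peirce 1 (Δ (halfPlus a b)) : Set Y) ∧
        Δ '' (hilbertPerp {a, b} : Set X) = (hilbertPerp {a', b'} : Set Y) ∧
        hilbertPerp {a', b'} = T.peirce 1 (Δ (halfPlus a b)) ∧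
        T.peirce 1 (Δ (halfPlus a b)) = hilbertPerp {Δ (halfPlus a b), Δ (halfMinus a b)} ∧
        Δ '' (S.peirce 0 (halfPlus a b) : Set X) = (T.peirce 0 (Δ (halfPlus a b)) : Set Y)) ∧
    -- (d)
    (∀ a b c : X, S.RealOrthonormal ![a, b, c] →
      (S.IsIsomorphicTo (S.generated {a, b, c}) matrixS2 ∧
        ∃ N : Submodule ℂ Y, T.IsIsomorphicTo N matrixS2 ∧
          Δ '' (S.generated {a, b, c} : Set X) = (N : Set Y)) ∨
      (∃ d : X, S.RealOrthonormal ![a, b, c, d] ∧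
        S.IsIsomorphicTo (S.generated {a, b, c, d}) matrixM2 ∧
        ∃ N : Submodule ℂ Y, T.IsIsomorphicTo N matrixM2 ∧
          Δ '' (S.generated {a, b, c, d} : Set X) = (N : Set Y))) ∧
    -- the consequence for pairs of minimal tripotents
    (∀ e v : X, S.IsMinimalTripotent e → S.IsMinimalTripotent v →
      ∃ (M : Submodule ℂ X) (N : Submodule ℂ Y),
        e ∈ M ∧ v ∈ M ∧ Δ '' (M : Set X) = (N : Set Y) ∧
        ((S.IsIsomorphicTo M matrixM2 ∧ T.IsIsomorphicTo N matrixM2) ∨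
          (S.IsIsomorphicTo M matrixS2 ∧ T.IsIsomorphicTo N matrixS2))) := by
  obtain ⟨Δ, rfl⟩ : ∃ E : X ≃ Y, Δ = E := ⟨Equiv.ofBijective Δ hbij, rfl⟩
  have h : PreservesTruncations S T Δ := hΔ
  refine ⟨fun γ x hγ hx hn => ?_, fun a b hab => ?_, fun a b hab a' b' hab' he => ?_,
    fun a b c hv => Or.inl ?_, fun e v he hv => ?_⟩
  · obtain ⟨γ', y, h1, h2, h3, h4⟩ :=
      (h.isRankTwo_map (SpinFactor.isRankTwo_smul hγ hx hn)).exists_real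
    exact ⟨γ', y, h1, h2, h3, h4⟩
  · obtain ⟨ha, hb, -⟩ := SpinFactor.realOrthonormal_pair_iff.1 hab
    have hr := SpinFactor.isRankOne_halfPlus hab
    have hc := S.conj_halfPlus ha hb
    have hp1 : S.peirce 1 (halfPlus a b) = hilbertPerp {a, b} := by
      rw [hr.peirce_one, hc, SpinFactor.hilbertPerp_half]
    have hp0 : S.peirce 0 (halfPlus a b) = Submodule.span ℂ {halfMinus a b} := by
      rw [hr.peirce_zero, hc]
    have hdisj : Disjoint (hilbertPerp {a, b}) (Submodule.span ℂ {halfMinus a b}) := by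
      rw [← SpinFactor.hilbertPerp_half, ← hc]
      exact hr.disjoint
    refine ⟨?_, ?_, hdisj, ?_, fun a' b' hab' he => ⟨?_, ?_⟩⟩
    · obtain ⟨a', b', hab', he⟩ := h.exists_map_halfPlus hab
      refine ⟨(a', b'), ⟨hab', he⟩, ?_⟩
      rintro ⟨p, q⟩ ⟨hpq, hpe⟩
      obtain ⟨h1, h2⟩ := SpinFactor.halfPlus_injective hpq hab' (hpe.symm.trans he)
      exact Prod.ext h1 h2
    · rw [hp1, hp0]
      exact hdisj
    · rw [hp1, hp0]
    · obtain ⟨ha', hb', -⟩ := SpinFactor.realOrthonormal_pair_iff.1 hab'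
      rw [← SpinFactor.hilbertPerp_half, ← T.conj_halfPlus ha' hb']
      exact (SpinFactor.isRankOne_halfPlus hab').disjoint
    · obtain ⟨ha', hb', -⟩ := SpinFactor.realOrthonormal_pair_iff.1 hab'
      have hr' := SpinFactor.isRankOne_halfPlus hab'
      have hp1' : T.peirce 1 (halfPlus a' b') = hilbertPerp {a', b'} := by
        rw [hr'.peirce_one, T.conj_halfPlus ha' hb', SpinFactor.hilbertPerp_half]
      have hp0' : T.peirce 0 (halfPlus a' b') = Submodule.span ℂ {halfMinus a' b'} := by
        rw [hr'.peirce_zero, T.conj_halfPlus ha' hb']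
      rw [← hp1, ← hp0, ← hp1', ← hp0']
      ext y
      obtain ⟨x, rfl⟩ := Δ.surjective y
      rw [Δ.injective.mem_set_image, SetLike.mem_coe, SetLike.mem_coe,
        hr.peirce_one_sup_peirce_zero, hr'.peirce_one_sup_peirce_zero, ← he,
        h.inner_map_eq_zero_iff hr]
  · obtain ⟨ha, hb, -⟩ := SpinFactor.realOrthonormal_pair_iff.1 hab
    obtain ⟨ha', hb', -⟩ := SpinFactor.realOrthonormal_pair_iff.1 hab'
    have hr := SpinFactor.isRankOne_halfPlus hab
    have hr' := h.isRankOne_map hr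
    have hp1 : S.peirce 1 (halfPlus a b) = hilbertPerp {a, b} := by
      rw [hr.peirce_one, S.conj_halfPlus ha hb, SpinFactor.hilbertPerp_half]
    have hp1' : T.peirce 1 (Δ (halfPlus a b)) = hilbertPerp {a', b'} := by
      rw [hr'.peirce_one, he, T.conj_halfPlus ha' hb', SpinFactor.hilbertPerp_half]
    have himage : Δ '' (hilbertPerp {a, b} : Set X) = (hilbertPerp {a', b'} : Set Y) := by
      ext y
      obtain ⟨x, rfl⟩ := Δ.surjective y
      rw [Δ.injective.mem_set_image, SetLike.mem_coe, SetLike.mem_coe,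
        h.map_mem_hilbertPerp_iff hab hab' he]
    refine ⟨hp1, by rw [hp1, hp1', himage], himage, hp1'.symm, ?_, ?_⟩
    · -- `Δ((a - ib)/2)` is a nonzero multiple of the conjugate of `Δ((a + ib)/2)`
      obtain ⟨r, hr0, hre⟩ := h.exists_map_conj hr
      rw [hr'.peirce_one, ← S.conj_halfPlus ha hb, hre]
      ext y
      rw [SpinFactor.mem_hilbertPerp_pair, SpinFactor.mem_hilbertPerp_pair, inner_smul_left,
        mul_eq_zero]
      simp [hr0]
    · ext y
      obtain ⟨x, rfl⟩ := Δ.surjective y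
      rw [Δ.injective.mem_set_image, SetLike.mem_coe, SetLike.mem_coe, hr.peirce_zero,
        hr'.peirce_zero, h.map_mem_span_conj_iff hr]
  · obtain ⟨w, hw, himage⟩ := h.exists_image_triple hv
    rw [← SpinFactor.range_triple, hv.generated_eq]
    exact ⟨hv.isIsomorphicTo_matrixS2, _, hw.isIsomorphicTo_matrixS2, himage⟩
  · rw [SpinFactor.isMinimalTripotent_iff] at he hv
    rcases he.exists_mem_span hv with ⟨a, b, c, ho, he', hv'⟩ | ⟨a, b, c, d, ho, he', hv'⟩
    · obtain ⟨w, hw, himage⟩ := h.exists_image_triple ho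
      exact ⟨_, _, he', hv', himage, Or.inr ⟨ho.isIsomorphicTo_matrixS2,
        hw.isIsomorphicTo_matrixS2⟩⟩
    · obtain ⟨w, hw, himage⟩ := h.exists_image_quadruple ho
      exact ⟨_, _, he', hv', himage, Or.inl ⟨ho.isIsomorphicTo_matrixM2,
        hw.isIsomorphicTo_matrixM2⟩⟩
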